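/- **Setting.** Let $\Omega\subset\mathbb R^2$ be a bounded open polygon (with $\Omega=\mathrm{int}\,\overline\Omega$), with outward unit normal $\mathbf n=(n_1,n_2)$ at almost every boundary point. Put $\partial_0\Omega=\{n_1\neq 0\}$, $\partial_-\Omega=\{n_1=0,\ xn_2<0\}$. Let $\mathcal T$ be a triangulation of $\Omega$ into finitely many disjoint open triangles whose closures cover $\overline\Omega$ exactly; $h|_T=\mathrm{diam}(T)$; $\mathcal T$ is shape-regular with constant $\sigma$ ($h_T\le\sigma\rho_T$, $\rho_T$ the inradius) and locally quasi-uniform with constant $\varrho$ ($h_T\le\varrho h_{T'}$ for adjacent elements). $\Gamma_{\rm int}$ is the part of $\bigcup_T\partial T$ inside $\Omega$. For $p\ge2$ let $V_h$ be the space of continuous functions on $\overline\Omega$ that are polynomials of total degree $\le p$ on each $T$ and vanish on $\partial_-\Omega\cup\partial_0\Omega$. On an interface between $T^\pm$ let $\{w\}=(w^++w^-)/2$, $[\![w]\!]=w^+\mathbf n^++w^-\mathbf n^-$, $[v]_1=v^+n_1^++v^-n_1^-$; on $\partial\Omega$ let $\{w\}=w$, $[\![w]\!]=w\mathbf n$,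 $[v]_1=vn_1$. $(\cdot,\cdot)$ and $\|\cdot\|$ are the inner product and norm of $L_2(\Omega)$, and $\nabla_{\mathcal T}$ is the elementwise gradient. Let $A=\begin{pmatrix}\alpha&\beta\\ \beta&\gamma\end{pmatrix}$ be non-negative definite, $\kappa,\lambda\ge0$, $\tau=C_\tau p^2/\{h\}$, and $$\begin{aligned}s_h(U,V)=&-\int_{\Gamma_{\rm int}\cup\partial_-\Omega}(0,x)^T\cdot\big(\alpha[\![U_x]\!]\{V_x\}+\beta[\![U_x]\!]\{V_y\}+\beta[\![U_y]\!]\{V_x\}+\gamma[\![U_y]\!]\{V_y\}\big)\,ds\\&+\int_{\Gamma_{\rm int}}\tfrac{|xn_2|}{2}\big(\kappa[\![U_x]\!]\cdot[\![V_x]\!]+\lambda[\![U_y]\!]\cdot[\![V_y]\!]\big)\,ds\\&-\int_{\Gamma_{\rm int}\cup\partial_0\Omega}\big(\{A\nabla U_x\}\cdot[\nabla V]_1+\{A\nabla V_x\}\cdot[\nabla U]_1-\tau[\nabla U]_1\cdot A[\nabla V]_1\big)\,ds.\end{aligned}$$ The semidiscrete finite element method for $u_t-u_{xx}+xu_y=0$,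 $u(0)=u_0\in L_2(\Omega)$, $u=0$ on $\partial_-\Omega\cup\partial_0\Omega$, is: find $U(t)\in V_h$ with $U(0)=\Pi u_0$ (the orthogonal $L_2$-projection onto $V_h$) such that for all $t\in(0,t_f]$ and all $V\in V_h$ $$(U_t,V)+(\nabla U_t,A\nabla V)+(U_x,V_x)+(xU_y,V)+(A\nabla_{\mathcal T}U_x,\nabla_{\mathcal T}V_x)+(\nabla_{\mathcal T}(xU_y),A\nabla V)+s_h(U,V)=0.$$ For $0<\epsilon<1$ let $B=\mathrm{diag}\big(2(1-\epsilon),\,2\beta-\alpha^2/(2\epsilon)\big)$, and let $\mu$ be the smallest eigenvalue of $B-A$. Call $(\alpha,\beta,\gamma,\epsilon)$ admissible if $0<\alpha<1/2$, $0<\gamma<\beta<1$, $0<\epsilon<1$, $A$ is non-negative definite and $\mu>0$. **Theorem (decay via hypocoercivity).** (i) There is a Poincaré–Friedrichs constant $C_{PF}=C_{PF}(\Omega)>0$: $\|V\|^2\le C_{PF}\|\nabla V\|^2$ for all $V\in V_h$, for all triangulations and all $p$. (ii) For every $0<\alpha<1/2$ there are $\beta,\gamma,\epsilon$ such that $(\alpha,\beta,\gamma,\epsilon)$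 is admissible. (iii) There is a $C_0>0$, depending only on $\Omega,\sigma,\varrho$ (not on $h$ or $p$), such that for all $C_\tau\ge C_0$, all admissible $(\alpha,\beta,\gamma,\epsilon)$, all $C_{PF}$ as in (i), with $c_0:=\mu/C_{PF}$, and for all such $\mathcal T$, $p\ge2$, $\kappa,\lambda\ge 0$, $u_0\in L_2(\Omega)$ and $t_f>0$, the solution $U$ of the method satisfies $$\|U(t_f)\|^2+\|\sqrt A\nabla U(t_f)\|^2\le e^{-\min\{1,c_0\}t_f}\big(\|\Pi u_0\|^2+\|\sqrt A\nabla\Pi u_0\|^2\big),$$ and consequently $$\|U(t_f)\|+\|\sqrt A\nabla U(t_f)\|\le\sqrt2\,e^{-\min\{1,c_0\}t_f/2}\big(\|\Pi u_0\|+\|\sqrt A\nabla\Pi u_0\|\big).$$ -/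

import Mathlib

open scoped Matrix

noncomputable section

namespace KolmogorovFEM

/-- The plane with the Euclidean norm; `z 0` is the coordinate `x` and `z 1` is the coordinate `y`. -/
abbrev Plane := EuclideanSpace ℝ (Fin 2)

/-- Polynomials in the two variables `x` (index `0`) and `y` (index `1`). -/
abbrev Poly := MvPolynomial (Fin 2) ℝ

/-- The value of a polynomial at a point. -/
def ev (q : Poly) (z : Plane) : ℝ := MvPolynomial.eval (fun i => z i) q

/-- The partial derivatives `q_x` and `q_y`. -/
def dx (q : Poly) : Poly := MvPolynomial.pderiv 0 q

def dy (q : Poly) : Poly := MvPolynomial.pderiv 1 q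

/-- The gradient of a polynomial at a point. -/
def grad (q : Poly) (z : Plane) : Fin 2 → ℝ := ![ev (dx q) z, ev (dy q) z]

/-! ### The boundary of the domain -/

/-- `n` is the outward unit normal of `Ω` at the boundary point `z`, where `∂Ω` is locally a line
(for a polygon these are all boundary points except the corners): near `z`, the set `Ω` is the
open half plane `(w - z) · n < 0`. -/
def IsOutwardNormal (Ω : Set Plane) (z n : Plane) : Prop :=
  ‖n‖ = 1 ∧ ∃ r > 0, ∀ w ∈ Metric.ball z r, (w ∈ Ω ↔ inner ℝ (w - z) n < 0)

/-- The elliptic part `∂₀Ω` of the boundary: `n₁ ≠ 0`. -/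
def ellipticBoundary (Ω : Set Plane) : Set Plane :=
  {z | ∃ n, IsOutwardNormal Ω z n ∧ n 0 ≠ 0}

/-- The inflow part `∂₋Ω` of the boundary: `n₁ = 0` and `x n₂ < 0`. -/
def inflowBoundary (Ω : Set Plane) : Set Plane :=
  {z | ∃ n, IsOutwardNormal Ω z n ∧ n 0 = 0 ∧ z 0 * n 1 < 0}

/-! ### Triangles and triangulations -/

/-- A nondegenerate triangle, given by its vertices. -/
structure Triangle where
  vert : Fin 3 → Plane
  indep : AffineIndependent ℝ vert

namespace Triangle

/-- The closed triangle. -/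
def closed (T : Triangle) : Set Plane := convexHull ℝ (Set.range T.vert)

/-- The open triangle. -/
def opn (T : Triangle) : Set Plane := interior T.closed

/-- The local mesh size `h_T = diam T`. -/
def h (T : Triangle) : ℝ := Metric.diam T.closed

/-- The direction vector of the edge opposite to vertex `i`, which joins the vertices `i + 1`
and `i + 2`. -/
def edgeVec (T : Triangle) (i : Fin 3) : Plane := T.vert (i + 2) - T.vert (i + 1)

/-- A unit vector orthogonal to the edge opposite to vertex `i`. -/
def edgePerp (T : Triangle) (i : Fin 3) : Plane :=
  ‖T.edgeVec i‖⁻¹ • !₂[T.edgeVec i 1, -(T.edgeVec i 0)]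

/-- The outward unit normal of `T` on the edge opposite to vertex `i`: the unit vector orthogonal
to the edge that points away from vertex `i`. -/
def normal (T : Triangle) (i : Fin 3) : Plane :=
  (-Real.sign (inner ℝ (T.vert i - T.vert (i + 1)) (T.edgePerp i))) • T.edgePerp i

/-- The line integral `∫_{e ∩ S} f ds`, where `e` is the edge of `T` opposite to vertex `i`. -/
def edgeIntegral (T : Triangle) (i : Fin 3) (S : Set Plane) (f : Plane → ℝ) : ℝ :=
  ‖T.edgeVec i‖ *
    ∫ s in (0 : ℝ)..1, S.indicator f (AffineMap.lineMap (T.vert (i + 1)) (T.vert (i + 2)) s)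

end Triangle

/-- A triangulation of `Ω`: finitely many mutually disjoint open triangles whose closures cover
the closure of `Ω` exactly. -/
structure Triangulation (Ω : Set Plane) where
  n : ℕ
  tri : Fin n → Triangle
  disjoint : ∀ j k, j ≠ k → Disjoint (tri j).opn (tri k).opn
  cover : ⋃ j, (tri j).closed = closure Ω

namespace Triangulation

variable {Ω : Set Plane}

/-- Shape regularity: the diameter of each triangle is at most `σ` times the radius of some
inscribed circle. -/
def ShapeRegular (𝒯 : Triangulation Ω) (σ : ℝ) : Prop :=
  ∀ j, ∃ c : Plane, ∃ r > 0, Metric.closedBall c r ⊆ (𝒯.tri j).closed ∧ (𝒯.tri j).h ≤ σ * r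

/-- Local quasi-uniformity: the diameters of two triangles which share (a part of) an edge are
comparable. -/
def LocallyQuasiUniform (𝒯 : Triangulation Ω) (ρ : ℝ) : Prop :=
  ∀ j k, ((𝒯.tri j).closed ∩ (𝒯.tri k).closed).Nontrivial → (𝒯.tri j).h ≤ ρ * (𝒯.tri k).h

/-- Piecewise polynomials: one polynomial for each triangle. -/
abbrev PW (𝒯 : Triangulation Ω) := Fin 𝒯.n → Poly

/-- The finite element space `V_h^p`: piecewise polynomials of total degree at most `p`, continuous
across the interfaces, and zero on `∂₋Ω ∪ ∂₀Ω`. -/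
def feSpace (𝒯 : Triangulation Ω) (p : ℕ) : Submodule ℝ 𝒯.PW where
  carrier := {V |
    (∀ j, (V j).totalDegree ≤ p) ∧
    (∀ j k, ∀ z ∈ (𝒯.tri j).closed ∩ (𝒯.tri k).closed, ev (V j) z = ev (V k) z) ∧
    (∀ j, ∀ z ∈ (𝒯.tri j).closed ∩ (inflowBoundary Ω ∪ ellipticBoundary Ω), ev (V j) z = 0)}
  add_mem' := by
    rintro a b ⟨ha1, ha2, ha3⟩ ⟨hb1, hb2, hb3⟩
    refine ⟨fun j => ?_, fun j k z hz => ?_, fun j z hz => ?_⟩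
    · exact (MvPolynomial.totalDegree_add _ _).trans (max_le (ha1 j) (hb1 j))
    · have h1 := ha2 j k z hz
      have h2 := hb2 j k z hz
      simp only [ev, Pi.add_apply, map_add] at *
      rw [h1, h2]
    · have h1 := ha3 j z hz
      have h2 := hb3 j z hz
      simp only [ev, Pi.add_apply, map_add] at *
      rw [h1, h2, add_zero]
  zero_mem' := by
    refine ⟨fun j => ?_, fun j k z hz => ?_, fun j z hz => ?_⟩ <;> simp [ev]
  smul_mem' := by
    rintro c a ⟨ha1, ha2, ha3⟩
    refine ⟨fun j => ?_, fun j k z hz => ?_, fun j z hz => ?_⟩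
    · exact (MvPolynomial.totalDegree_smul_le _ _).trans (ha1 j)
    · have h1 := ha2 j k z hz
      simp only [ev, Pi.smul_apply, MvPolynomial.smul_eval] at *
      rw [h1]
    · have h1 := ha3 j z hz
      simp only [ev, Pi.smul_apply, MvPolynomial.smul_eval] at *
      rw [h1, mul_zero]

/-! ### Volume terms -/

/-- The inner product `(W, V)` of `L₂(Ω)`. -/
def l2 (𝒯 : Triangulation Ω) (W V : 𝒯.PW) : ℝ :=
  ∑ j, ∫ z in (𝒯.tri j).opn, ev (W j) z * ev (V j) z

/-- The form `(∇W, A∇V)`. For `V = W` this is `‖√A ∇W‖²`. -/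
def energy (𝒯 : Triangulation Ω) (A : Matrix (Fin 2) (Fin 2) ℝ) (W V : 𝒯.PW) : ℝ :=
  ∑ j, ∫ z in (𝒯.tri j).opn, grad (W j) z ⬝ᵥ A *ᵥ grad (V j) z

/-- `(W_x, V_x) + (x W_y, V) + (A ∇W_x, ∇V_x) + (∇(x W_y), A∇V)` with broken gradients. -/
def volumeForm (𝒯 : Triangulation Ω) (A : Matrix (Fin 2) (Fin 2) ℝ) (W V : 𝒯.PW) : ℝ :=
  ∑ j, ∫ z in (𝒯.tri j).opn,
    (ev (dx (W j)) z * ev (dx (V j)) z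
      + z 0 * ev (dy (W j)) z * ev (V j) z
      + (A *ᵥ grad (dx (W j)) z) ⬝ᵥ grad (dx (V j)) z
      + grad (MvPolynomial.X 0 * dy (W j)) z ⬝ᵥ A *ᵥ grad (V j) z)

/-! ### Jumps, averages and the numerical fluxes -/

/-- The jump `w⁺ n⁺ + w⁻ n⁻` of a scalar, with `n⁺ = n` and `n⁻ = -n`. -/
def jump (n : Plane) (wp wm : ℝ) : Fin 2 → ℝ := fun i => wp * n i + wm * (-n i)

/-- The jump `[v]₁ = v⁺ n₁⁺ + v⁻ n₁⁻` of a vector. -/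
def jumpOne (n : Plane) (vp vm : Fin 2 → ℝ) : Fin 2 → ℝ := n 0 • vp + (-n 0) • vm

/-- The average of a scalar. -/
def avg (wp wm : ℝ) : ℝ := (wp + wm) / 2

/-- The average of a vector. -/
def avgVec (vp vm : Fin 2 → ℝ) : Fin 2 → ℝ := (2 : ℝ)⁻¹ • (vp + vm)

/-- The density of `s_h` on an interface, where `wp, vp` are the polynomials on the side with
outward normal `n` and `wm, vm` those on the other side. -/
def fluxInterior (A : Matrix (Fin 2) (Fin 2) ℝ) (κ lam τ : ℝ) (n : Plane) (wp wm vp vm : Poly)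
    (z : Plane) : ℝ :=
  let jwx := jump n (ev (dx wp) z) (ev (dx wm) z)
  let jwy := jump n (ev (dy wp) z) (ev (dy wm) z)
  let jvx := jump n (ev (dx vp) z) (ev (dx vm) z)
  let jvy := jump n (ev (dy vp) z) (ev (dy vm) z)
  let avx := avg (ev (dx vp) z) (ev (dx vm) z)
  let avy := avg (ev (dy vp) z) (ev (dy vm) z)
  let jw := jumpOne n (grad wp z) (grad wm z)
  let jv := jumpOne n (grad vp z) (grad vm z)
  let aw := avgVec (A *ᵥ grad (dx wp) z) (A *ᵥ grad (dx wm) z)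
  let av := avgVec (A *ᵥ grad (dx vp) z) (A *ᵥ grad (dx vm) z)
  let advection :=
    ![0, z 0] ⬝ᵥ (A 0 0 • avx • jwx + A 0 1 • avy • jwx + A 1 0 • avx • jwy + A 1 1 • avy • jwy)
  let upwind := |z 0 * n 1| / 2 * (κ * (jwx ⬝ᵥ jvx) + lam * (jwy ⬝ᵥ jvy))
  let penalty := aw ⬝ᵥ jv + av ⬝ᵥ jw - τ * (jw ⬝ᵥ A *ᵥ jv)
  upwind - advection - penalty

/-- The density of `s_h` on `∂₋Ω`. On the boundary, jumps are `w n` and averages are `w`. -/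
def fluxInflow (A : Matrix (Fin 2) (Fin 2) ℝ) (n : Plane) (w v : Poly) (z : Plane) : ℝ :=
  let jwx := jump n (ev (dx w) z) 0
  let jwy := jump n (ev (dy w) z) 0
  let advection := ![0, z 0] ⬝ᵥ (A 0 0 • ev (dx v) z • jwx + A 0 1 • ev (dy v) z • jwx
    + A 1 0 • ev (dx v) z • jwy + A 1 1 • ev (dy v) z • jwy)
  Neg.neg advection

/-- The density of `s_h` on `∂₀Ω`. -/
def fluxElliptic (A : Matrix (Fin 2) (Fin 2) ℝ) (τ : ℝ) (n : Plane) (w v : Poly) (z : Plane) : ℝ :=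
  let jw := jumpOne n (grad w z) 0
  let jv := jumpOne n (grad v z) 0
  let penalty := (A *ᵥ grad (dx w) z) ⬝ᵥ jv + (A *ᵥ grad (dx v) z) ⬝ᵥ jw - τ * (jw ⬝ᵥ A *ᵥ jv)
  Neg.neg penalty

/-- The stabilisation `s_h(W, V)` with `τ = C_τ p² / {h}`. The interfaces are the sets
`∂T_j ∩ ∂T_k ∩ Ω` with `j < k`. -/
def sForm (𝒯 : Triangulation Ω) (p : ℕ) (A : Matrix (Fin 2) (Fin 2) ℝ) (κ lam Cτ : ℝ)
    (W V : 𝒯.PW) : ℝ :=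
  (∑ j, ∑ k, if j < k then
      ∑ i, (𝒯.tri j).edgeIntegral i ((𝒯.tri k).closed ∩ Ω)
        (fluxInterior A κ lam (Cτ * (p : ℝ) ^ 2 / avg (𝒯.tri j).h (𝒯.tri k).h)
          ((𝒯.tri j).normal i) (W j) (W k) (V j) (V k))
    else 0)
  + (∑ j, ∑ i, (𝒯.tri j).edgeIntegral i (inflowBoundary Ω)
      (fluxInflow A ((𝒯.tri j).normal i) (W j) (V j)))
  + (∑ j, ∑ i, (𝒯.tri j).edgeIntegral i (ellipticBoundary Ω)
      (fluxElliptic A (Cτ * (p : ℝ) ^ 2 / (𝒯.tri j).h) ((𝒯.tri j).normal i) (W j) (V j)))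

/-! ### The semidiscrete method -/

/-- `P` is the orthogonal `L₂`-projection `Π u₀` of `u₀` onto `V_h^p`. -/
def IsL2Projection (𝒯 : Triangulation Ω) (p : ℕ) (u₀ : Plane → ℝ) (P : 𝒯.PW) : Prop :=
  P ∈ 𝒯.feSpace p ∧
    ∀ V ∈ 𝒯.feSpace p, 𝒯.l2 P V = ∑ j, ∫ z in (𝒯.tri j).opn, u₀ z * ev (V j) z

/-- `U : [0, t_f] → V_h^p` solves the semidiscrete finite element method for the homogeneous problem
(`f = 0`) with initial value `P`. Continuity and differentiability in time are those of
the coefficients, that is, of a curve in the finite-dimensional space `V_h^p`. -/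
structure IsFEMSolution (𝒯 : Triangulation Ω) (p : ℕ) (A : Matrix (Fin 2) (Fin 2) ℝ)
    (κ lam Cτ tf : ℝ) (P : 𝒯.PW) (U : ℝ → 𝒯.PW) : Prop where
  mem : ∀ t ∈ Set.Icc 0 tf, U t ∈ 𝒯.feSpace p
  init : U 0 = P
  continuous : ∀ j m, ContinuousOn (fun t => (U t j).coeff m) (Set.Icc 0 tf)
  equation : ∀ t ∈ Set.Ioc 0 tf, ∃ Ut ∈ 𝒯.feSpace p,
    (∀ j m, HasDerivWithinAt (fun s => (U s j).coeff m) ((Ut j).coeff m) (Set.Icc 0 tf) t) ∧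
    ∀ V ∈ 𝒯.feSpace p,
      𝒯.l2 Ut V + 𝒯.energy A Ut V + 𝒯.volumeForm A (U t) V + 𝒯.sForm p A κ lam Cτ (U t) V = 0

end Triangulation

/-- `C` is a Poincaré–Friedrichs constant of `Ω` for functions that vanish on `∂₋Ω ∪ ∂₀Ω`:
`‖V‖² ≤ C ‖∇V‖²` on all finite element spaces over all triangulations of `Ω`. -/
def IsPoincareConstant (Ω : Set Plane) (C : ℝ) : Prop :=
  0 < C ∧ ∀ (𝒯 : Triangulation Ω) (p : ℕ), ∀ V ∈ 𝒯.feSpace p, 𝒯.l2 V V ≤ C * 𝒯.energy 1 V V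

/-! ### The coefficient matrices -/

/-- The matrix `A`. -/
def matA (α β γ : ℝ) : Matrix (Fin 2) (Fin 2) ℝ := !![α, β; β, γ]

/-- The matrix `B = diag(2(1 - ε), 2β - α²/(2ε))`. -/
def matB (α β ε : ℝ) : Matrix (Fin 2) (Fin 2) ℝ :=
  !![2 * (1 - ε), 0; 0, 2 * β - α ^ 2 / (2 * ε)]

/-- Admissible parameters: `A` is non-negative definite, and the smallest eigenvalue `μ` of `B - A`
is positive. -/
structure Admissible (α β γ ε μ : ℝ) : Prop where
  α_pos : 0 < α
  α_lt : α < 1 / 2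
  γ_pos : 0 < γ
  γ_lt : γ < β
  β_lt : β < 1
  ε_pos : 0 < ε
  ε_lt : ε < 1
  posSemidef : (matA α β γ).PosSemidef
  isLeast : IsLeast (spectrum ℝ (matB α β ε - matA α β γ)) μ
  μ_pos : 0 < μ

end KolmogorovFEM

end

open KolmogorovFEM

open scoped Matrix

noncomputable section

namespace KolmogorovFEM

/-! The equation dissipates only `U_x`. The commutator of `∂_x` with `x ∂_y` is `∂_y`, so
differentiating the transport term and pairing it with `A∇U` produces the missing dissipation. For
`V = U` the volume density splits into `U_x² + α U_x U_y + β U_y²`, the form `A∇U_x · ∇U_x`, and the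
exact derivative `∂_y (x (U² + A∇U · ∇U) / 2)` (`volume_density_eq`). By Young's inequality the
first part is at least half the quadratic form of `B`, which dominates that of `A + μ`. With the
Poincaré–Friedrichs inequality it controls `min 1 (μ / C) / 2` times the squared modified norm
(`l2_add_energy_le_of_admissible`).

The surface terms must then not spoil the sign (`surface_nonneg`). The divergence theorem moves the
exact derivative to the edges. On an interface `U` is continuous and the advective flux cancels the
jump of `A∇U · ∇U`. On the inflow boundary the flux turns the sign of the transport term, and where
`n₁ = 0` and `x n₂ ≥ 0` that term already has the right sign. Where `n₁ ≠ 0`, `U` vanishes and half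
of the penalty absorbs the term, because `n₁²` is bounded below there. The consistency terms are
completed to squares with the penalty, which leaves traces of `A∇U_x · ∇U_x` weighted by a multiple
of `h / p²`. The inverse trace estimate `Triangle.sum_edge_gradQuad_le` bounds these by the volume
term `A∇U_x · ∇U_x`, with a constant independent of `h` and `p`; this is why `τ` scales like `p² /
h`. Its core is the one-dimensional end-point estimate `eval_zero_sq_le`.

Together this gives coercivity (`hypocoercive_le`), and testing with `V = U(t)` yields a
differential inequality that integrates to the decay (`IsFEMSolution.decay`). The
Poincaré–Friedrichs constant comes from integrating `(x V²)_x`, whose boundary part vanishes since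
`V = 0` wherever `n₁ ≠ 0`. -/

/-! ### Legendre polynomials and the end-point inverse estimate -/

open Polynomial in
theorem eval_iterate_derivative_eq_zero_of_pow_dvd {w : ℝ[X]} {a : ℝ} {n k : ℕ}
    (h : (X - C a) ^ n ∣ w) (hk : k < n) : (derivative^[k] w).eval a = 0 := by
  have h1 := pow_sub_dvd_iterate_derivative_of_pow_dvd k h
  have h2 : (X - C a) ∣ derivative^[k] w :=
    (dvd_pow_self _ (by omega)).trans h1
  exact dvd_iff_isRoot.1 h2

open Polynomial in
theorem integral_derivative_mul (p q : ℝ[X]) :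
    ∫ x in (0 : ℝ)..1, p.derivative.eval x * q.eval x =
      p.eval 1 * q.eval 1 - p.eval 0 * q.eval 0
        - ∫ x in (0 : ℝ)..1, p.eval x * q.derivative.eval x := by
  have h := intervalIntegral.integral_mul_deriv_eq_deriv_mul (a := (0 : ℝ)) (b := 1)
    (u := fun x => q.eval x) (v := fun x => p.eval x) (u' := fun x => q.derivative.eval x)
    (v' := fun x => p.derivative.eval x) (fun x _ => q.hasDerivAt x) (fun x _ => p.hasDerivAt x)
    (Continuous.intervalIntegrable (by fun_prop) _ _)
    (Continuous.intervalIntegrable (by fun_prop) _ _)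
  simp only [mul_comm (Polynomial.eval _ p), mul_comm (Polynomial.eval _ (derivative p))] at h ⊢
  linarith

-- Repeated integration by parts: each boundary term vanishes because `w` has zeros of order `n` at
-- both ends, and each step lowers the degree of `q` until it is zero.
open Polynomial in
theorem integral_iterate_derivative_mul_eq_zero {w : ℝ[X]} {n : ℕ}
    (h0 : (X - C 0) ^ n ∣ w) (h1 : (X - C 1) ^ n ∣ w) {k : ℕ} (hk : k ≤ n) {q : ℝ[X]}
    (hq : q.degree < k) : ∫ x in (0 : ℝ)..1, (derivative^[k] w).eval x * q.eval x = 0 := by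
  induction k generalizing q with
  | zero =>
    have : q = 0 := by
      rw [← degree_eq_bot]
      simpa using hq
    simp [this]
  | succ k ih =>
    rw [Function.iterate_succ_apply', integral_derivative_mul,
      eval_iterate_derivative_eq_zero_of_pow_dvd h0 hk,
      eval_iterate_derivative_eq_zero_of_pow_dvd h1 hk, ih (by omega)]
    · ring
    · by_cases hq0 : q = 0
      · simp [hq0]
      · rw [degree_eq_natDegree hq0] at hq
        have hq' : q.natDegree < k + 1 := by exact_mod_cast hq
        by_cases hd : q.natDegree = 0
        · rw [eq_C_of_natDegree_eq_zero hd]; simp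
        · have := degree_derivative_lt hq0
          rw [degree_eq_natDegree hq0] at this
          exact this.trans_le (by exact_mod_cast Nat.lt_succ_iff.1 hq')

open Polynomial in
/-- The shifted Legendre polynomial with real coefficients. -/
def legendre (n : ℕ) : ℝ[X] := (shiftedLegendre n).map (Int.castRingHom ℝ)

open Polynomial in
theorem factorial_mul_legendre (n : ℕ) :
    C (n.factorial : ℝ) * legendre n = derivative^[n] (X ^ n * (1 - X) ^ n) := by
  have := congrArg (Polynomial.map (Int.castRingHom ℝ)) (factorial_mul_shiftedLegendre_eq n)
  rw [← iterate_derivative_map] at this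
  simpa [legendre] using this

open Polynomial in
theorem integral_legendre_mul_eq_zero {n : ℕ} {q : ℝ[X]} (hq : q.degree < n) :
    ∫ x in (0 : ℝ)..1, (legendre n).eval x * q.eval x = 0 := by
  have h := integral_iterate_derivative_mul_eq_zero (w := X ^ n * (1 - X) ^ n) (n := n)
    (by simp) (by
      refine Dvd.dvd.mul_left ?_ _
      exact pow_dvd_pow_of_dvd ⟨-1, by simp⟩ n) le_rfl hq
  rw [← factorial_mul_legendre] at h
  simp only [eval_mul, eval_C, mul_assoc, intervalIntegral.integral_const_mul] at h
  exact (mul_eq_zero.1 h).resolve_left (by positivity)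

open Polynomial in
theorem eval_zero_legendre (n : ℕ) : (legendre n).eval 0 = 1 := by
  rw [← coeff_zero_eq_eval_zero]
  simp [legendre, coeff_shiftedLegendre]

open Polynomial in
theorem eval_one_legendre_sq (n : ℕ) : (legendre n).eval 1 ^ 2 = 1 := by
  have h := shiftedLegendre_eval_symm n (1 : ℝ)
  have e : ∀ x : ℝ, aeval x (shiftedLegendre n) = (legendre n).eval x := by
    intro x; simp [legendre, aeval_def, eval_map]
  rw [e, e, sub_self, eval_zero_legendre] at h
  rw [h, mul_one, ← pow_mul, mul_comm, pow_mul]; simp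

open Polynomial in
theorem natDegree_legendre_le (n : ℕ) : (legendre n).natDegree ≤ n := by
  simpa [legendre] using natDegree_map_le (f := Int.castRingHom ℝ) (p := shiftedLegendre n)

open Polynomial in
theorem coeff_legendre_ne_zero (n : ℕ) : (legendre n).coeff n ≠ 0 := by
  simp [legendre, coeff_shiftedLegendre, (Nat.choose_pos (show n ≤ n + n by simp)).ne']

open Polynomial in
theorem degree_lt_of_natDegree_le_of_coeff {n : ℕ} {q : ℝ[X]} (h : q.degree < (n + 1 : ℕ))
    (h0 : q.coeff n = 0) : q.degree < n := by
  rw [degree_lt_iff_coeff_zero] at h ⊢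
  intro m hm
  rcases hm.eq_or_lt with rfl | hm
  · exact h0
  · exact h m hm

-- Integrate `L' · (x L)` by parts. The leading terms of `x L' - n L` cancel, so it is orthogonal to
-- `L` and `∫ x L L' = n ∫ L²`; the boundary term is `L(1)² = 1`.
open Polynomial in
theorem integral_legendre_sq (n : ℕ) :
    (2 * n + 1) * ∫ x in (0 : ℝ)..1, (legendre n).eval x ^ 2 = 1 := by
  set L := legendre n
  have h1 := integral_derivative_mul L (X * L)
  have h2 : ∫ x in (0 : ℝ)..1, L.eval x * (X * derivative L - C (n : ℝ) * L).eval x = 0 := by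
    refine integral_legendre_mul_eq_zero (degree_lt_of_natDegree_le_of_coeff ?_ ?_)
    · rw [degree_lt_iff_coeff_zero]
      intro m hm
      have hL : ∀ m, n < m → L.coeff m = 0 := fun m hm =>
        coeff_eq_zero_of_natDegree_lt ((natDegree_legendre_le n).trans_lt hm)
      cases m with
      | zero => omega
      | succ m =>
        rw [coeff_sub, coeff_X_mul, coeff_derivative, coeff_C_mul, hL _ (by omega)]; simp
    · cases n with
      | zero => simp
      | succ m =>
        rw [coeff_sub, coeff_X_mul, coeff_derivative, coeff_C_mul]; push_cast; ring
  have i1 : ∀ f : ℝ[X], IntervalIntegrable (fun x => f.eval x) MeasureTheory.volume 0 1 := fun f =>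
    Continuous.intervalIntegrable (by fun_prop) _ _
  have key : ∀ f g : ℝ[X], ∫ x in (0:ℝ)..1, (f + g).eval x =
      (∫ x in (0:ℝ)..1, f.eval x) + ∫ x in (0:ℝ)..1, g.eval x := fun f g => by
    simp only [eval_add]; exact intervalIntegral.integral_add (i1 f) (i1 g)
  have h3 : ∫ x in (0 : ℝ)..1, L.eval x * (X * derivative L).eval x =
      n * ∫ x in (0 : ℝ)..1, L.eval x ^ 2 := by
    have := key (L * (X * derivative L - C (n : ℝ) * L)) (C (n : ℝ) * L ^ 2)
    rw [show L * (X * derivative L - C (n : ℝ) * L) + C (n : ℝ) * L ^ 2 = L * (X * derivative L) by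
      ring] at this
    simp only [eval_mul, eval_pow, eval_C, intervalIntegral.integral_const_mul] at this h2 ⊢
    rw [this, h2, zero_add]
  have h4 : ∫ x in (0 : ℝ)..1, L.eval x * (derivative (X * L)).eval x =
      (∫ x in (0 : ℝ)..1, L.eval x ^ 2) + ∫ x in (0 : ℝ)..1, L.eval x * (X * derivative L).eval x := by
    have := key (L ^ 2) (L * (X * derivative L))
    simp only [eval_mul, eval_pow] at this ⊢
    rw [← this]
    congr 1; ext x
    simp [derivative_mul]; ring
  have h5 : ∫ x in (0 : ℝ)..1, (derivative L).eval x * (X * L).eval x =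
      ∫ x in (0 : ℝ)..1, L.eval x * (X * derivative L).eval x := by
    congr 1; ext x; simp; ring
  have h6 : L.eval 1 ^ 2 = 1 := eval_one_legendre_sq n
  rw [h5, h4, h3] at h1
  simp only [eval_mul, eval_X] at h1
  nlinarith

open Polynomial in
/-- The sharp inverse estimate for the value of a polynomial at an end point. -/
theorem eval_zero_sq_le (n : ℕ) {q : ℝ[X]} (hq : q.degree < n) :
    q.eval 0 ^ 2 ≤ n ^ 2 * ∫ x in (0 : ℝ)..1, q.eval x ^ 2 := by
  induction n generalizing q with
  | zero =>
    have : q = 0 := by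
      rw [← degree_eq_bot]
      simpa using hq
    simp [this]
  | succ n ih =>
    -- Split off the component along the Legendre polynomial of degree `n`; the remainder `r` has
    -- lower degree and is orthogonal to it.
    set L := legendre n with hL
    set c := q.coeff n / L.coeff n
    set r := q - C c * L with hr
    have hrd : r.degree < n := by
      refine degree_lt_of_natDegree_le_of_coeff ?_ ?_
      · refine (degree_sub_le _ _).trans_lt (max_lt hq ?_)
        refine degree_le_natDegree.trans_lt ?_
        have := (natDegree_C_mul_le c L).trans (natDegree_legendre_le n)
        exact_mod_cast Nat.lt_succ_of_le this
      · rw [hr, coeff_sub, coeff_C_mul, div_mul_cancel₀ _ (coeff_legendre_ne_zero n), sub_self]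
    have hrb := ih hrd
    have ho := integral_legendre_mul_eq_zero hrd
    have hn := integral_legendre_sq n
    rw [← hL] at ho hn
    have hqr : q = C c * L + r := by rw [hr]; ring
    have hint : ∫ x in (0 : ℝ)..1, q.eval x ^ 2 =
        c ^ 2 * (∫ x in (0 : ℝ)..1, L.eval x ^ 2) + ∫ x in (0 : ℝ)..1, r.eval x ^ 2 := by
      have e : ∀ x, q.eval x ^ 2 = c ^ 2 * L.eval x ^ 2 + 2 * c * (L.eval x * r.eval x)
          + r.eval x ^ 2 := by
        intro x; rw [hqr]; simp; ring
      simp only [e]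
      rw [intervalIntegral.integral_add, intervalIntegral.integral_add,
        intervalIntegral.integral_const_mul, intervalIntegral.integral_const_mul, ho]
      · ring
      all_goals exact Continuous.intervalIntegrable (by fun_prop) _ _
    have h0 : q.eval 0 = c + r.eval 0 := by
      rw [hqr]; simp [hL, eval_zero_legendre]
    have hS : 0 ≤ ∫ x in (0 : ℝ)..1, r.eval x ^ 2 :=
      intervalIntegral.integral_nonneg (by norm_num) (fun x _ => by positivity)
    rw [hint, h0]
    set S := ∫ x in (0 : ℝ)..1, r.eval x ^ 2
    set N := ∫ x in (0 : ℝ)..1, L.eval x ^ 2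
    set r0 := r.eval 0
    have hN : N = 1 / (2 * n + 1) := by field_simp; linarith
    rw [hN]
    push_cast
    rcases Nat.eq_zero_or_pos n with rfl | hpos
    · have : r0 = 0 := by
        have : r0 ^ 2 ≤ 0 := by simpa using hrb
        nlinarith
      rw [this]; simp; nlinarith
    · have hn1 : (1 : ℝ) ≤ n := by exact_mod_cast hpos
      set m : ℝ := (n : ℝ)
      -- Cauchy–Schwarz for `(c + r0)²` with weights `2m + 1` and `m²`, which add up to `(m + 1)²`;
      -- the defect is written as an explicit square. The division by `m²` is why `n = 0` is treated
      -- apart.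
      have e : (m + 1) ^ 2 * (c ^ 2 * (1 / (2 * m + 1)) + S) - (c + r0) ^ 2 =
          ((m ^ 2 * c - (2 * m + 1) * r0) ^ 2 + (2 * m + 1) ^ 2 * (m ^ 2 * S - r0 ^ 2))
            / ((2 * m + 1) * m ^ 2) + (m ^ 2 * S - r0 ^ 2) := by
        field_simp; ring
      have : 0 ≤ ((m ^ 2 * c - (2 * m + 1) * r0) ^ 2 + (2 * m + 1) ^ 2 * (m ^ 2 * S - r0 ^ 2))
            / ((2 * m + 1) * m ^ 2) := by
        apply div_nonneg _ (by positivity)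
        have : 0 ≤ m ^ 2 * S - r0 ^ 2 := by linarith
        positivity
      linarith

/-! ### Geometry of a triangle -/

/-- The cross product of two vectors of the plane. -/
def cross (u v : Plane) : ℝ := u 0 * v 1 - u 1 * v 0

theorem inner_plane (u v : Plane) : inner ℝ u v = u 0 * v 0 + u 1 * v 1 := by
  simp [PiLp.inner_apply, Fin.sum_univ_two]; ring

theorem sum_fin_three_cyclic {M : Type*} [AddCommMonoid M] (f : Fin 3 → M) (i : Fin 3) :
    ∑ j, f j = f i + f (i + 1) + f (i + 2) := by
  rw [Fin.sum_univ_three]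
  fin_cases i
  · rfl
  · change _ = f 1 + f 2 + f 0; abel
  · change _ = f 2 + f 0 + f 1; abel

theorem fin_three_eq (i j : Fin 3) : j = i ∨ j = i + 1 ∨ j = i + 2 := by
  revert i j; decide

namespace Triangle

variable (T : Triangle)

/-- The affine basis given by the vertices. -/
def basis : AffineBasis (Fin 3) ℝ Plane :=
  ⟨T.vert, T.indep, T.indep.affineSpan_eq_top_iff_card_eq_finrank_add_one.2 (by simp)⟩

/-- Twice the signed area. -/
def det : ℝ := cross (T.edgeVec 0) (T.vert 0 - T.vert 1)

/-- The signed area is the same from every vertex, so a single sign, that of `det`, orients all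
three normals in `normal_eq`. -/
theorem cross_edgeVec (i : Fin 3) : cross (T.edgeVec i) (T.vert i - T.vert (i + 1)) = T.det := by
  fin_cases i
  · rfl
  · simp only [cross, edgeVec, det, Fin.reduceFinMk, Fin.isValue]
    change _ = (T.vert 2 - T.vert 1).ofLp 0 * (T.vert 0 - T.vert 1).ofLp 1 -
      (T.vert 2 - T.vert 1).ofLp 1 * (T.vert 0 - T.vert 1).ofLp 0
    change (T.vert 0 - T.vert 2).ofLp 0 * (T.vert 1 - T.vert 2).ofLp 1 -
      (T.vert 0 - T.vert 2).ofLp 1 * (T.vert 1 - T.vert 2).ofLp 0 = _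
    simp only [PiLp.sub_apply]; ring
  · change (T.vert 1 - T.vert 0).ofLp 0 * (T.vert 2 - T.vert 0).ofLp 1 -
      (T.vert 1 - T.vert 0).ofLp 1 * (T.vert 2 - T.vert 0).ofLp 0 =
      (T.vert 2 - T.vert 1).ofLp 0 * (T.vert 0 - T.vert 1).ofLp 1 -
      (T.vert 2 - T.vert 1).ofLp 1 * (T.vert 0 - T.vert 1).ofLp 0
    simp only [PiLp.sub_apply]; ring

theorem cross_edgeVec_sub (i : Fin 3) (z : Plane) :
    cross (T.edgeVec i) (z - T.vert (i + 1)) = T.basis.coord i z * T.det := by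
  have h1 := T.basis.linear_combination_coord_eq_self z
  have h2 := T.basis.sum_coord_apply_eq_one z
  rw [sum_fin_three_cyclic _ i] at h1 h2
  have h0 := congrArg (fun w : Plane => w 0) h1
  have h3 := congrArg (fun w : Plane => w 1) h1
  change (_ • T.vert i + _ • T.vert (i + 1) + _ • T.vert (i + 2)).ofLp 0 = _ at h0
  change (_ • T.vert i + _ • T.vert (i + 1) + _ • T.vert (i + 2)).ofLp 1 = _ at h3
  simp only [PiLp.add_apply, PiLp.smul_apply, smul_eq_mul] at h0 h3
  rw [← T.cross_edgeVec i]
  simp only [cross, edgeVec, PiLp.sub_apply]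
  rw [← h0, ← h3]
  have : T.basis.coord i z = 1 - T.basis.coord (i + 1) z - T.basis.coord (i + 2) z := by linarith
  rw [this]; ring

theorem vert_ne {i j : Fin 3} (h : i ≠ j) : T.vert i ≠ T.vert j :=
  fun e => h (T.indep.injective e)

theorem edgeVec_ne_zero (i : Fin 3) : T.edgeVec i ≠ 0 :=
  sub_ne_zero.2 (T.vert_ne (by revert i; decide))

theorem norm_edgeVec_pos (i : Fin 3) : 0 < ‖T.edgeVec i‖ := norm_pos_iff.2 (T.edgeVec_ne_zero i)

theorem det_ne_zero : T.det ≠ 0 := by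
  intro h
  apply T.edgeVec_ne_zero 0
  have := fun z => T.cross_edgeVec_sub 0 z
  simp only [h, mul_zero, cross, PiLp.sub_apply] at this
  have h1 := this (T.vert (0 + 1) + !₂[1, 0])
  have h2 := this (T.vert (0 + 1) + !₂[0, 1])
  simp at h1 h2
  ext i; fin_cases i
  · simpa using h2
  · simpa using h1

/-- The barycentric coordinates. -/
def bary (i : Fin 3) (z : Plane) : ℝ := cross (T.edgeVec i) (z - T.vert (i + 1)) / T.det

theorem bary_eq_coord (i : Fin 3) (z : Plane) : T.bary i z = T.basis.coord i z := by
  rw [bary, T.cross_edgeVec_sub, mul_div_cancel_right₀ _ T.det_ne_zero]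

theorem continuous_bary (i : Fin 3) : Continuous (T.bary i) := by
  unfold bary cross; fun_prop

theorem sum_bary (z : Plane) : ∑ i, T.bary i z = 1 := by
  simp only [bary_eq_coord]; exact T.basis.sum_coord_apply_eq_one z

theorem sum_bary_smul (z : Plane) : ∑ i, T.bary i z • T.vert i = z := by
  simp only [bary_eq_coord]; exact T.basis.linear_combination_coord_eq_self z

theorem closed_eq : T.closed = convexHull ℝ (Set.range T.basis) := rfl

theorem mem_closed_iff {z : Plane} : z ∈ T.closed ↔ ∀ i, 0 ≤ T.bary i z := by
  rw [closed_eq, T.basis.convexHull_eq_nonneg_coord]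
  simp [bary_eq_coord]

theorem mem_opn_iff {z : Plane} : z ∈ T.opn ↔ ∀ i, 0 < T.bary i z := by
  rw [opn, closed_eq, T.basis.interior_convexHull]
  simp [bary_eq_coord]

theorem isCompact_closed : IsCompact T.closed := (Set.finite_range _).isCompact_convexHull ℝ

theorem isClosed_closed : IsClosed T.closed := T.isCompact_closed.isClosed

theorem isOpen_opn : IsOpen T.opn := isOpen_interior

theorem opn_subset_closed : T.opn ⊆ T.closed := interior_subset

theorem convex_closed : Convex ℝ T.closed := convex_convexHull ℝ _

theorem opn_nonempty : T.opn.Nonempty := ⟨_, T.basis.centroid_mem_interior_convexHull⟩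

theorem closed_subset_closure_opn : T.closed ⊆ closure T.opn := by
  rw [opn, T.convex_closed.closure_interior_eq_closure_of_nonempty_interior T.opn_nonempty]
  exact subset_closure

theorem vert_mem_closed (i : Fin 3) : T.vert i ∈ T.closed :=
  subset_convexHull ℝ _ ⟨i, rfl⟩

/-- The closed edge opposite to vertex `i`. -/
def edge (i : Fin 3) : Set Plane := segment ℝ (T.vert (i + 1)) (T.vert (i + 2))

theorem edge_subset_closed (i : Fin 3) : T.edge i ⊆ T.closed :=
  T.convex_closed.segment_subset (T.vert_mem_closed _) (T.vert_mem_closed _)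

theorem isCompact_edge (i : Fin 3) : IsCompact (T.edge i) := by
  rw [edge, segment_eq_image_lineMap]
  exact isCompact_Icc.image (by fun_prop)

theorem bary_eq_zero_of_mem_edge {i : Fin 3} {z : Plane} (h : z ∈ T.edge i) : T.bary i z = 0 := by
  obtain ⟨a, b, -, -, hab, rfl⟩ := h
  have : a = 1 - b := by linarith
  subst this
  simp only [bary, cross, edgeVec, PiLp.sub_apply, PiLp.add_apply, PiLp.smul_apply, smul_eq_mul]
  ring

theorem mem_edge_of_bary_eq_zero {i : Fin 3} {z : Plane} (h : z ∈ T.closed)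
    (h0 : T.bary i z = 0) : z ∈ T.edge i := by
  have h1 := T.sum_bary z
  have h2 := T.sum_bary_smul z
  rw [sum_fin_three_cyclic _ i, h0] at h1 h2
  rw [T.mem_closed_iff] at h
  exact ⟨_, _, h (i + 1), h (i + 2), by linarith, by simpa using h2⟩

/-- The set of the vertices. -/
def vertices : Set Plane := Set.range T.vert

theorem bary_pos_of_mem_edge {i j : Fin 3} (hij : j ≠ i) {z : Plane} (h : z ∈ T.edge i)
    (hz : z ∉ T.vertices) : 0 < T.bary j z := by
  have hc := T.edge_subset_closed i h
  rw [T.mem_closed_iff] at hc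
  refine (hc j).lt_of_ne fun h0 => hz ?_
  have h1 := T.sum_bary z
  have h2 := T.sum_bary_smul z
  have hi := T.bary_eq_zero_of_mem_edge h
  rw [sum_fin_three_cyclic _ i, hi] at h1 h2
  rcases fin_three_eq i j with rfl | rfl | rfl
  · exact absurd rfl hij
  · rw [← h0] at h1 h2
    have : T.bary (i + 2) z = 1 := by linarith
    rw [this] at h2
    exact ⟨i + 2, by simpa using h2⟩
  · rw [← h0] at h1 h2
    have : T.bary (i + 1) z = 1 := by linarith
    rw [this] at h2
    exact ⟨i + 1, by simpa using h2⟩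

/-- The distance of vertex `i` from the opposite edge. -/
def height (i : Fin 3) : ℝ := |T.det| / ‖T.edgeVec i‖

theorem height_pos (i : Fin 3) : 0 < T.height i :=
  div_pos (abs_pos.2 T.det_ne_zero) (T.norm_edgeVec_pos i)

theorem inner_edgePerp (i : Fin 3) (w : Plane) :
    inner ℝ w (T.edgePerp i) = -(‖T.edgeVec i‖⁻¹ * cross (T.edgeVec i) w) := by
  simp [inner_plane, edgePerp, cross]; ring

theorem normal_eq (i : Fin 3) : T.normal i = Real.sign T.det • T.edgePerp i := by
  rw [normal, inner_edgePerp, T.cross_edgeVec]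
  congr 1
  have := T.norm_edgeVec_pos i
  rcases T.det_ne_zero.lt_or_gt with h | h
  · rw [Real.sign_of_neg h, Real.sign_of_pos]
    exact neg_pos.2 (mul_neg_of_pos_of_neg (by positivity) h)
  · rw [Real.sign_of_pos h, Real.sign_of_neg, neg_neg]
    exact neg_neg_of_pos (by positivity)

theorem norm_edgePerp (i : Fin 3) : ‖T.edgePerp i‖ = 1 := by
  have h : ‖(!₂[T.edgeVec i 1, -(T.edgeVec i 0)] : Plane)‖ = ‖T.edgeVec i‖ := by
    simp [EuclideanSpace.norm_eq, Fin.sum_univ_two, add_comm]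
  rw [edgePerp, norm_smul, h, norm_inv, norm_norm, inv_mul_cancel₀ (T.norm_edgeVec_pos i).ne']

theorem norm_normal (i : Fin 3) : ‖T.normal i‖ = 1 := by
  rw [normal_eq, norm_smul, norm_edgePerp, mul_one, Real.norm_eq_abs]
  rcases T.det_ne_zero.lt_or_gt with h | h
  · simp [Real.sign_of_neg h]
  · simp [Real.sign_of_pos h]

theorem norm_edgeVec_mul_inner_normal (i : Fin 3) (w : Plane) :
    ‖T.edgeVec i‖ * inner ℝ w (T.normal i) = -(Real.sign T.det * cross (T.edgeVec i) w) := by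
  rw [normal_eq, inner_smul_right, inner_edgePerp]
  have := (T.norm_edgeVec_pos i).ne'
  field_simp

theorem sign_mul_self (x : ℝ) : Real.sign x * x = |x| := by
  rcases lt_trichotomy x 0 with h | h | h
  · simp [Real.sign_of_neg h, abs_of_neg h]
  · simp [h]
  · simp [Real.sign_of_pos h, abs_of_pos h]

/-- A barycentric coordinate is the distance from an edge in units of the height. Questions about
the half plane at an edge thus become questions about the sign of one coordinate. -/
theorem inner_sub_normal (i : Fin 3) (z : Plane) :
    inner ℝ (z - T.vert (i + 1)) (T.normal i) = -(T.height i * T.bary i z) := by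
  have h := T.norm_edgeVec_mul_inner_normal i (z - T.vert (i + 1))
  have h0 := (T.norm_edgeVec_pos i).ne'
  have h2 : cross (T.edgeVec i) (z - T.vert (i + 1)) = T.bary i z * T.det := by
    rw [bary, div_mul_cancel₀ _ T.det_ne_zero]
  rw [h2] at h
  rw [height, ← sign_mul_self]
  field_simp
  linarith

theorem inner_sub_normal_of_mem_edge {i : Fin 3} {z : Plane} (hz : z ∈ T.edge i) (w : Plane) :
    inner ℝ (w - z) (T.normal i) = -(T.height i * T.bary i w) := by
  have h1 := T.inner_sub_normal i z
  rw [T.bary_eq_zero_of_mem_edge hz] at h1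
  rw [← sub_sub_sub_cancel_right w z (T.vert (i + 1)), inner_sub_left, h1, T.inner_sub_normal]
  ring

/-- Away from the vertices a triangle is locally a half plane at each point of an edge. -/
theorem exists_ball_of_mem_edge {i : Fin 3} {z : Plane} (hz : z ∈ T.edge i)
    (hv : z ∉ T.vertices) : ∃ r > 0, ∀ w ∈ Metric.ball z r,
      (w ∈ T.opn ↔ inner ℝ (w - z) (T.normal i) < 0) ∧
      (w ∈ T.closed ↔ inner ℝ (w - z) (T.normal i) ≤ 0) := by
  have h : ∀ᶠ w in nhds z, ∀ j, j ≠ i → 0 < T.bary j w := by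
    rw [Filter.eventually_all]
    intro j
    by_cases hj : j = i
    · simp [hj]
    · have := (T.continuous_bary j).continuousAt.eventually
        (lt_mem_nhds (T.bary_pos_of_mem_edge hj hz hv))
      filter_upwards [this] with w hw _ using hw
  obtain ⟨r, hr, h⟩ := Metric.eventually_nhds_iff_ball.1 h
  refine ⟨r, hr, fun w hw => ?_⟩
  have h := h w hw
  have hh := T.height_pos i
  rw [T.inner_sub_normal_of_mem_edge hz, T.mem_opn_iff, T.mem_closed_iff]
  constructor
  · rw [neg_lt_zero, mul_pos_iff_of_pos_left hh]
    refine ⟨fun H => H i, fun H j => ?_⟩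
    by_cases hj : j = i
    · exact hj ▸ H
    · exact h j hj
  · rw [neg_nonpos, mul_nonneg_iff_of_pos_left hh]
    refine ⟨fun H => H i, fun H j => ?_⟩
    by_cases hj : j = i
    · exact hj ▸ H
    · exact (h j hj).le

theorem edge_unique {i j : Fin 3} {z : Plane} (hi : z ∈ T.edge i) (hj : z ∈ T.edge j)
    (hv : z ∉ T.vertices) : i = j := by
  by_contra h
  exact (T.bary_pos_of_mem_edge (Ne.symm h) hi hv).ne' (T.bary_eq_zero_of_mem_edge hj)

theorem mem_opn_or_mem_edge {z : Plane} (h : z ∈ T.closed) : z ∈ T.opn ∨ ∃ i, z ∈ T.edge i := by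
  by_cases h0 : ∃ i, T.bary i z = 0
  · obtain ⟨i, hi⟩ := h0
    exact Or.inr ⟨i, T.mem_edge_of_bary_eq_zero h hi⟩
  · push Not at h0
    exact Or.inl (T.mem_opn_iff.2 fun i => (T.mem_closed_iff.1 h i).lt_of_ne (h0 i).symm)

/-- A disc in a triangle has diameter at most each height. -/
theorem two_mul_le_height {c : Plane} {r : ℝ} (hr : 0 < r)
    (h : Metric.closedBall c r ⊆ T.closed) (i : Fin 3) : 2 * r ≤ T.height i := by
  have hn : inner ℝ (T.normal i) (T.normal i) = (1 : ℝ) := by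
    rw [real_inner_self_eq_norm_sq, T.norm_normal]; norm_num
  -- Between the two ends of the diameter parallel to the normal, the coordinate `bary i` changes by
  -- `2 * r / height i`, while it stays in `[0, 1]`.
  have hmem : ∀ s : ℝ, |s| ≤ r → c + s • T.normal i ∈ T.closed := fun s hs =>
    h (by simpa [norm_smul, T.norm_normal] using hs)
  have h1 := hmem r (abs_of_pos hr).le
  have h2 := hmem (-r) (by rw [abs_neg, abs_of_pos hr])
  have hle : ∀ z ∈ T.closed, T.bary i z ≤ 1 := fun z hz => by
    rw [← T.sum_bary z]
    exact Finset.single_le_sum (fun j _ => T.mem_closed_iff.1 hz j) (Finset.mem_univ i)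
  have e1 := T.inner_sub_normal i (c + r • T.normal i)
  have e2 := T.inner_sub_normal i (c + (-r) • T.normal i)
  rw [add_sub_right_comm, inner_add_left, inner_smul_left, hn] at e1 e2
  have b1 := T.mem_closed_iff.1 h1 i
  have b2 := hle _ h2
  have hh := T.height_pos i
  rw [neg_smul] at b2
  simp at e1 e2
  nlinarith

theorem h_pos : 0 < T.h := by
  have h1 : dist (T.vert 0) (T.vert 1) ≤ T.h :=
    Metric.dist_le_diam_of_mem T.isCompact_closed.isBounded (T.vert_mem_closed 0)
      (T.vert_mem_closed 1)
  exact (dist_pos.2 (T.vert_ne (by decide))).trans_le h1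

end Triangle

/-! ### Integration over a triangle -/

open MeasureTheory

/-- The integral over the standard simplex as an iterated integral. -/
theorem integral_simplex {f : ℝ × ℝ → ℝ} (hf : Continuous f) :
    ∫ q in {q : ℝ × ℝ | 0 ≤ q.1 ∧ 0 ≤ q.2 ∧ q.1 + q.2 ≤ 1}, f q =
      ∫ t in (0 : ℝ)..1, (1 - t) * ∫ s in (0 : ℝ)..1, f (t, (1 - t) * s) := by
  set R : Set (ℝ × ℝ) := {q | 0 ≤ q.1 ∧ 0 ≤ q.2 ∧ q.1 + q.2 ≤ 1} with hR
  have hRc : IsClosed R := by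
    refine (isClosed_le (f := fun _ => (0 : ℝ)) continuous_const continuous_fst).inter
      ((isClosed_le (f := fun _ => (0 : ℝ)) continuous_const continuous_snd).inter
        (isClosed_le (f := fun q : ℝ × ℝ => q.1 + q.2) (by fun_prop) continuous_const))
  have hRk : IsCompact R := by
    refine (isCompact_Icc (a := ((0 : ℝ), (0 : ℝ))) (b := (1, 1))).of_isClosed_subset hRc ?_
    rintro ⟨t, s⟩ ⟨h1, h2, h3⟩
    simp only at h1 h2 h3
    exact ⟨⟨h1, h2⟩, ⟨by simp; linarith, by simp; linarith⟩⟩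
  have hint : Integrable (R.indicator f) :=
    (integrable_indicator_iff hRc.measurableSet).2 (hf.continuousOn.integrableOn_compact hRk)
  rw [← integral_indicator hRc.measurableSet]
  rw [show (volume : Measure (ℝ × ℝ)) = volume.prod volume from rfl] at hint ⊢
  rw [integral_prod _ hint, intervalIntegral.integral_of_le zero_le_one,
    ← integral_Icc_eq_integral_Ioc, ← integral_indicator measurableSet_Icc]
  congr 1
  ext t
  by_cases ht : t ∈ Set.Icc (0 : ℝ) 1
  · rw [Set.indicator_of_mem ht]
    have e : (fun s => R.indicator f (t, s)) = (Set.Icc 0 (1 - t)).indicator fun s => f (t, s) := by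
      ext s
      by_cases hs : s ∈ Set.Icc 0 (1 - t)
      · rw [Set.indicator_of_mem hs, Set.indicator_of_mem]
        exact ⟨ht.1, hs.1, by simpa using by linarith [hs.2]⟩
      · rw [Set.indicator_of_notMem hs, Set.indicator_of_notMem]
        rintro ⟨-, h2, h3⟩
        exact hs ⟨h2, by simp only at h3; linarith⟩
    rw [e, integral_indicator measurableSet_Icc, integral_Icc_eq_integral_Ioc,
      ← intervalIntegral.integral_of_le (by linarith [ht.2])]
    have := intervalIntegral.smul_integral_comp_mul_left (a := 0) (b := 1)
      (fun s => f (t, s)) (1 - t)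
    simp only [smul_eq_mul, mul_zero, mul_one] at this
    exact this.symm
  · rw [Set.indicator_of_notMem ht]
    have e : (fun s => R.indicator f (t, s)) = 0 := by
      ext s
      rw [Set.indicator_of_notMem]; · rfl
      rintro ⟨h1, h2, h3⟩
      simp only at h1 h2 h3
      exact ht ⟨h1, by linarith⟩
    rw [e]; simp

theorem det_linear_plane (u v : Plane) (f : Plane →L[ℝ] Plane)
    (hf : ∀ w, f w = w 0 • u + w 1 • v) : f.det = cross u v := by
  rw [ContinuousLinearMap.det, ← LinearMap.det_toMatrix (EuclideanSpace.basisFun (Fin 2) ℝ).toBasis,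
    Matrix.det_fin_two]
  simp [LinearMap.toMatrix_apply, hf, cross]; ring

theorem fin_three_add_two_add_one (i : Fin 3) : i + 2 + 1 = i := by revert i; decide

theorem fin_three_add_two_add_two (i : Fin 3) : i + 2 + 2 = i + 1 := by revert i; decide

theorem fin_three_add_one_add_one (i : Fin 3) : i + 1 + 1 = i + 2 := by revert i; decide

theorem fin_three_add_one_add_two (i : Fin 3) : i + 1 + 2 = i := by revert i; decide

theorem plane_eta (w : Plane) : !₂[w 0, w 1] = w := by
  ext k; fin_cases k <;> rfl

namespace Triangle

variable (T : Triangle)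

theorem ae_opn_eq_closed : T.opn =ᵐ[volume] T.closed :=
  interior_ae_eq_of_null_frontier (T.convex_closed.addHaar_frontier volume)

theorem integral_opn (f : Plane → ℝ) : ∫ z in T.opn, f z = ∫ z in T.closed, f z :=
  setIntegral_congr_set T.ae_opn_eq_closed

/-- The integral over a triangle, in coordinates where the edge opposite to vertex `i` and its
parallels are parametrised by `s`. -/
theorem integral_eq_iterated (i : Fin 3) {f : Plane → ℝ} (hf : Continuous f) :
    ∫ z in T.opn, f z = |T.det| * ∫ t in (0 : ℝ)..1, (1 - t) * ∫ s in (0 : ℝ)..1,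
      f (AffineMap.lineMap (AffineMap.lineMap (T.vert (i + 1)) (T.vert i) t : Plane)
        (AffineMap.lineMap (T.vert (i + 2)) (T.vert i) t) s) := by
  set u : Plane := T.vert i - T.vert (i + 1)
  set v : Plane := T.edgeVec i
  let A : Plane →L[ℝ] Plane :=
    (EuclideanSpace.proj (0 : Fin 2) : Plane →L[ℝ] ℝ).smulRight u +
      (EuclideanSpace.proj (1 : Fin 2) : Plane →L[ℝ] ℝ).smulRight v
  have hA : ∀ w, A w = w 0 • u + w 1 • v := fun w => by simp [A]
  have hdet : A.det = -T.det := by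
    rw [det_linear_plane u v A hA, ← T.cross_edgeVec i]; simp only [cross, u, v]; ring
  let g : Plane → Plane := fun w => T.vert (i + 1) + A w
  let R : Set Plane := {w | 0 ≤ w 0 ∧ 0 ≤ w 1 ∧ w 0 + w 1 ≤ 1}
  -- The barycentric coordinates of `g w` are `w 0`, `1 - w 0 - w 1` and `w 1`, so `g` maps the
  -- standard simplex `R` bijectively onto the triangle.
  have hb0 : ∀ w, T.bary i (g w) = w 0 := by
    intro w
    have : cross (T.edgeVec i) (g w - T.vert (i + 1)) = w 0 * T.det := by
      rw [← T.cross_edgeVec i]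
      simp only [g, hA, add_sub_cancel_left, cross, PiLp.add_apply, PiLp.smul_apply, smul_eq_mul,
        u, v]
      ring
    rw [bary, this, mul_div_cancel_right₀ _ T.det_ne_zero]
  have hsum : ∀ w, g w = w 0 • T.vert i + (1 - w 0 - w 1) • T.vert (i + 1)
      + w 1 • T.vert (i + 2) := by
    intro w; simp only [g, hA, u, v, edgeVec]; module
  have hb2 : ∀ w, T.bary (i + 2) (g w) = w 1 := by
    intro w
    have e : i + 2 + 1 = i := fin_three_add_two_add_one i
    have e' : i + 2 + 2 = i + 1 := fin_three_add_two_add_two i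
    have : cross (T.edgeVec (i + 2)) (g w - T.vert (i + 2 + 1)) = w 1 * T.det := by
      rw [← T.cross_edgeVec (i + 2), hsum, edgeVec, e, e']
      simp only [cross, PiLp.add_apply, PiLp.sub_apply, PiLp.smul_apply, smul_eq_mul]
      ring
    rw [bary, this, mul_div_cancel_right₀ _ T.det_ne_zero]
  have hb1 : ∀ w, T.bary (i + 1) (g w) = 1 - w 0 - w 1 := by
    intro w
    have := T.sum_bary (g w)
    rw [sum_fin_three_cyclic _ i, hb0, hb2] at this
    linarith
  have hmem : ∀ w, g w ∈ T.closed ↔ w ∈ R := by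
    intro w
    rw [T.mem_closed_iff]
    refine ⟨fun h => ⟨hb0 w ▸ h i, hb2 w ▸ h (i + 2), ?_⟩, ?_⟩
    · have := h (i + 1); rw [hb1] at this; linarith
    · rintro ⟨h0, h1, h2⟩ j
      rcases fin_three_eq i j with rfl | rfl | rfl
      · rwa [hb0]
      · rw [hb1]; linarith
      · rwa [hb2]
  have himg : g '' R = T.closed := by
    ext z
    refine ⟨?_, fun hz => ?_⟩
    · rintro ⟨w, hw, rfl⟩; exact (hmem w).2 hw
    · have hz' : g !₂[T.bary i z, T.bary (i + 2) z] = z := by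
        rw [hsum]
        have h1 := T.sum_bary z
        have h2 := T.sum_bary_smul z
        rw [sum_fin_three_cyclic _ i] at h1 h2
        have : T.bary (i + 1) z = 1 - T.bary i z - T.bary (i + 2) z := by linarith
        simpa [← this, add_assoc, ← sub_eq_add_neg] using h2
      exact ⟨_, (hmem _).1 (by rwa [hz']), hz'⟩
  have hinj : Set.InjOn g R := by
    intro w _ w' _ h
    ext k
    fin_cases k
    · have := congrArg (T.bary i) h; rwa [hb0, hb0] at this
    · have := congrArg (T.bary (i + 2)) h; rwa [hb2, hb2] at this
  have hRc : IsClosed R := by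
    refine (isClosed_le (f := fun _ => (0 : ℝ)) (g := fun w : Plane => w 0) continuous_const
      (by fun_prop)).inter ((isClosed_le (f := fun _ => (0 : ℝ)) (g := fun w : Plane => w 1)
        continuous_const (by fun_prop)).inter
        (isClosed_le (f := fun w : Plane => w 0 + w 1) (by fun_prop) continuous_const))
  rw [T.integral_opn, ← himg, integral_image_eq_integral_abs_det_fderiv_smul volume
    hRc.measurableSet (f' := fun _ => A)
    (fun w _ => (A.hasFDerivAt.const_add _).hasFDerivWithinAt) hinj]
  simp only [hdet, abs_neg, smul_eq_mul]
  rw [integral_const_mul]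
  congr 1
  have hmp : MeasurePreserving (fun w : Plane => (w 0, w 1)) :=
    (volume_preserving_finTwoArrow ℝ).comp (PiLp.volume_preserving_ofLp (Fin 2))
  have hemb : MeasurableEmbedding (fun w : Plane => (w 0, w 1)) :=
    (MeasurableEquiv.finTwoArrow (α := ℝ)).measurableEmbedding.comp
      (MeasurableEquiv.toLp 2 (Fin 2 → ℝ)).symm.measurableEmbedding
  have hgc : Continuous g := continuous_const.add A.continuous
  have hh : ∫ w in R, f (g !₂[w 0, w 1]) = _ :=
    (hmp.setIntegral_preimage_emb hemb (fun q : ℝ × ℝ => f (g !₂[q.1, q.2]))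
      {q : ℝ × ℝ | 0 ≤ q.1 ∧ 0 ≤ q.2 ∧ q.1 + q.2 ≤ 1}).trans (integral_simplex (by fun_prop))
  simp only [plane_eta] at hh
  refine hh.trans ?_
  congr 1
  ext t
  congr 2
  ext s
  congr 1
  rw [hsum]
  simp only [AffineMap.lineMap_apply_module]
  simp only [Fin.isValue, Matrix.cons_val_zero, Matrix.cons_val_one]
  module

end Triangle

/-! ### Polynomials on a triangle: divergence theorem and inverse trace estimate -/

theorem fin_three_add_one_ne_add_two (i : Fin 3) : i + 1 ≠ i + 2 := by revert i; decide

theorem continuous_ev (q : Poly) : Continuous (ev q) := by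
  unfold ev
  exact q.continuous_eval.comp (by fun_prop)

@[simp] theorem ev_add (q r : Poly) (z : Plane) : ev (q + r) z = ev q z + ev r z := by simp [ev]

@[simp] theorem ev_mul (q r : Poly) (z : Plane) : ev (q * r) z = ev q z * ev r z := by simp [ev]

@[simp] theorem ev_pow (q : Poly) (n : ℕ) (z : Plane) : ev (q ^ n) z = ev q z ^ n := by simp [ev]

@[simp] theorem ev_C (c : ℝ) (z : Plane) : ev (MvPolynomial.C c) z = c := by simp [ev]

@[simp] theorem ev_X (i : Fin 2) (z : Plane) : ev (MvPolynomial.X i) z = z i := by simp [ev]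

theorem dx_mul (q r : Poly) : dx (q * r) = dx q * r + q * dx r := by
  simp [dx, Derivation.leibniz]; ring

theorem dy_mul (q r : Poly) : dy (q * r) = dy q * r + q * dy r := by
  simp [dy, Derivation.leibniz]; ring

theorem dx_dy_comm (q : Poly) : dx (dy q) = dy (dx q) := by
  induction q using MvPolynomial.induction_on with
  | C c => simp [dx, dy]
  | add p q hp hq => simp only [dx, dy, map_add] at *; rw [hp, hq]
  | mul_X p i hp =>
    rw [dy_mul, dx_mul]
    simp only [dx, dy, map_add, Derivation.leibniz] at *
    rw [hp]
    fin_cases i <;> simp [MvPolynomial.pderiv_X] <;> ring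

open Polynomial in
/-- The restriction of a polynomial to the line through `a` and `b`. -/
def restrictLine (a b : Plane) (q : Poly) : ℝ[X] :=
  MvPolynomial.aeval (fun i => C (a i) + X * C (b i - a i)) q

theorem eval_restrictLine (a b : Plane) (q : Poly) (s : ℝ) :
    (restrictLine a b q).eval s = ev q (AffineMap.lineMap a b s) := by
  induction q using MvPolynomial.induction_on with
  | C c => simp [restrictLine, ev]
  | add p q hp hq => simp only [restrictLine, map_add, Polynomial.eval_add, ev_add] at *; rw [hp, hq]
  | mul_X p i hp =>
    simp only [restrictLine, map_mul, Polynomial.eval_mul, ev_mul, ev_X] at *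
    rw [hp]
    simp [AffineMap.lineMap_apply_module]; left; ring

theorem derivative_restrictLine (a b : Plane) (q : Poly) :
    (restrictLine a b q).derivative = restrictLine a b (dx q) * Polynomial.C ((b - a) 0) +
      restrictLine a b (dy q) * Polynomial.C ((b - a) 1) := by
  induction q using MvPolynomial.induction_on with
  | C c => simp [restrictLine, dx, dy]
  | add p q hp hq =>
    simp only [restrictLine, dx, dy, map_add] at *; rw [hp, hq]; ring
  | mul_X p i hp =>
    simp only [restrictLine, dx_mul, dy_mul, map_mul, map_add, Polynomial.derivative_mul] at *
    rw [hp]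
    fin_cases i <;> simp [dx, dy, MvPolynomial.pderiv_X] <;> ring

theorem degree_restrictLine_lt (a b : Plane) {q : Poly} {p : ℕ} (hq : q.totalDegree ≤ p) :
    (restrictLine a b q).degree < (p + 1 : ℕ) := by
  have h : (restrictLine a b q).natDegree ≤ p * 1 := by
    refine MvPolynomial.aeval_natDegree_le q hq _ fun i => ?_
    compute_degree
  rw [mul_one] at h
  exact Polynomial.degree_le_natDegree.trans_lt (by exact_mod_cast Nat.lt_succ_of_le h)

theorem integral_grad_lineMap (a b : Plane) (q : Poly) :
    ∫ s in (0 : ℝ)..1, (ev (dx q) (AffineMap.lineMap a b s) * (b - a) 0 +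
      ev (dy q) (AffineMap.lineMap a b s) * (b - a) 1) = ev q b - ev q a := by
  have h := intervalIntegral.integral_eq_sub_of_hasDerivAt (a := 0) (b := 1)
    (f := fun s => (restrictLine a b q).eval s) (fun x _ => (restrictLine a b q).hasDerivAt x)
    (Continuous.intervalIntegrable (by fun_prop) _ _)
  rw [derivative_restrictLine] at h
  simpa [eval_restrictLine] using h

/-- The inverse estimate for the value at the end point of a segment. -/
theorem ev_sq_le_integral (a b : Plane) {q : Poly} {p : ℕ} (hq : q.totalDegree ≤ p) :
    ev q a ^ 2 ≤ (p + 1) ^ 2 * ∫ s in (0 : ℝ)..1, ev q (AffineMap.lineMap a b s) ^ 2 := by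
  have h := eval_zero_sq_le (p + 1) (degree_restrictLine_lt a b hq)
  simpa [eval_restrictLine] using h

theorem integral_lineMap_comm (a b : Plane) (f : Plane → ℝ) :
    ∫ s in (0 : ℝ)..1, f (AffineMap.lineMap a b s) =
      ∫ s in (0 : ℝ)..1, f (AffineMap.lineMap b a s) := by
  have := intervalIntegral.integral_comp_sub_left (a := 0) (b := 1)
    (fun s => f (AffineMap.lineMap b a s)) 1
  simp only [sub_self, sub_zero, AffineMap.lineMap_apply_one_sub] at this
  exact this

theorem ev_sq_le_integral' (a b : Plane) {q : Poly} {p : ℕ} (hq : q.totalDegree ≤ p) :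
    ev q b ^ 2 ≤ (p + 1) ^ 2 * ∫ s in (0 : ℝ)..1, ev q (AffineMap.lineMap a b s) ^ 2 := by
  rw [integral_lineMap_comm a b (fun z => ev q z ^ 2)]
  exact ev_sq_le_integral b a hq

theorem continuous_integral_lineMap {f : Plane → ℝ} (hf : Continuous f) {a b : ℝ → Plane}
    (ha : Continuous a) (hb : Continuous b) :
    Continuous fun t => ∫ s in (0 : ℝ)..1, f (AffineMap.lineMap (a t) (b t) s) := by
  apply intervalIntegral.continuous_parametric_intervalIntegral_of_continuous'
  simp only [Function.uncurry_def, AffineMap.lineMap_apply_module]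
  fun_prop

namespace Triangle

variable (T : Triangle)

/-- The weight `1 - t` of the iterated integral is exactly the relative length of the parallel at
height `t`. The fundamental theorem on each parallel leaves the difference of its end values, and
the end points sweep the two other edges. -/
theorem integral_grad_edgeVec (i : Fin 3) (q : Poly) :
    ∫ z in T.opn, (ev (dx q) z * T.edgeVec i 0 + ev (dy q) z * T.edgeVec i 1) =
      |T.det| * ((∫ s in (0 : ℝ)..1, ev q (AffineMap.lineMap (T.vert (i + 2)) (T.vert i) s)) -
        ∫ s in (0 : ℝ)..1, ev q (AffineMap.lineMap (T.vert i) (T.vert (i + 1)) s)) := by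
  have hx := continuous_ev (dx q)
  have hy := continuous_ev (dy q)
  have hq := continuous_ev q
  have hl : ∀ a b : Plane, Continuous fun s : ℝ => (AffineMap.lineMap a b s : Plane) :=
    fun a b => AffineMap.lineMap_continuous
  rw [T.integral_eq_iterated i (by fun_prop),
    integral_lineMap_comm (T.vert i) (T.vert (i + 1)) (ev q),
    ← intervalIntegral.integral_sub]
  · congr 2
    ext t
    rw [← integral_grad_lineMap, ← intervalIntegral.integral_const_mul]
    congr 1
    ext s
    have e : (AffineMap.lineMap (T.vert (i + 2)) (T.vert i) t : Plane) -
        AffineMap.lineMap (T.vert (i + 1)) (T.vert i) t = (1 - t) • T.edgeVec i := by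
      simp only [AffineMap.lineMap_apply_module, edgeVec]; module
    rw [e]
    simp only [PiLp.smul_apply, smul_eq_mul]
    ring
  all_goals exact (hq.comp (hl _ _)).intervalIntegrable _ _

theorem edgeVec_sum : T.edgeVec 0 + T.edgeVec 1 + T.edgeVec 2 = 0 := by
  change T.vert 2 - T.vert 1 + (T.vert 0 - T.vert 2) + (T.vert 1 - T.vert 0) = 0
  abel

theorem integrableOn_opn {f : Plane → ℝ} (hf : Continuous f) : IntegrableOn f T.opn :=
  (hf.continuousOn.integrableOn_compact T.isCompact_closed).mono_set T.opn_subset_closed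

/-- Both sides are linear in `w`, so the two edge vectors treated by `integral_grad_edgeVec`
suffice: they span the plane, and the final linear combination is Cramer's rule. -/
theorem integral_grad (q : Poly) (w : Plane) :
    ∫ z in T.opn, (ev (dx q) z * w 0 + ev (dy q) z * w 1) =
      ∑ i, ‖T.edgeVec i‖ * inner ℝ w (T.normal i) * ∫ s in (0 : ℝ)..1,
        ev q (AffineMap.lineMap (T.vert (i + 1)) (T.vert (i + 2)) s) := by
  have hlin : ∀ w : Plane, ∫ z in T.opn, (ev (dx q) z * w 0 + ev (dy q) z * w 1) =
      (∫ z in T.opn, ev (dx q) z) * w 0 + (∫ z in T.opn, ev (dy q) z) * w 1 := by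
    intro w
    rw [integral_add, integral_mul_const, integral_mul_const]
    · exact (T.integrableOn_opn (continuous_ev _)).mul_const _
    · exact (T.integrableOn_opn (continuous_ev _)).mul_const _
  have h1 := T.integral_grad_edgeVec 1 q
  have h2 := T.integral_grad_edgeVec 2 q
  rw [hlin] at h1 h2 ⊢
  simp only [norm_edgeVec_mul_inner_normal, Fin.sum_univ_three]
  change _ = |T.det| * ((∫ s in (0 : ℝ)..1, ev q (AffineMap.lineMap (T.vert 0) (T.vert 1) s)) -
    ∫ s in (0 : ℝ)..1, ev q (AffineMap.lineMap (T.vert 1) (T.vert 2) s)) at h1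
  change _ = |T.det| * ((∫ s in (0 : ℝ)..1, ev q (AffineMap.lineMap (T.vert 1) (T.vert 2) s)) -
    ∫ s in (0 : ℝ)..1, ev q (AffineMap.lineMap (T.vert 2) (T.vert 0) s)) at h2
  change _ = _ * (∫ s in (0 : ℝ)..1, ev q (AffineMap.lineMap (T.vert 1) (T.vert 2) s)) +
    _ * (∫ s in (0 : ℝ)..1, ev q (AffineMap.lineMap (T.vert 2) (T.vert 0) s)) +
    _ * (∫ s in (0 : ℝ)..1, ev q (AffineMap.lineMap (T.vert 0) (T.vert 1) s))
  set P := ∫ z in T.opn, ev (dx q) z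
  set Q := ∫ z in T.opn, ev (dy q) z
  set I0 := ∫ s in (0 : ℝ)..1, ev q (AffineMap.lineMap (T.vert 1) (T.vert 2) s)
  set I1 := ∫ s in (0 : ℝ)..1, ev q (AffineMap.lineMap (T.vert 2) (T.vert 0) s)
  set I2 := ∫ s in (0 : ℝ)..1, ev q (AffineMap.lineMap (T.vert 0) (T.vert 1) s)
  have hd : T.det = T.edgeVec 1 0 * T.edgeVec 2 1 - T.edgeVec 1 1 * T.edgeVec 2 0 := by
    change (T.vert 2 - T.vert 1).ofLp 0 * (T.vert 0 - T.vert 1).ofLp 1 -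
      (T.vert 2 - T.vert 1).ofLp 1 * (T.vert 0 - T.vert 1).ofLp 0 =
      (T.vert 0 - T.vert 2).ofLp 0 * (T.vert 1 - T.vert 0).ofLp 1 -
      (T.vert 0 - T.vert 2).ofLp 1 * (T.vert 1 - T.vert 0).ofLp 0
    simp only [PiLp.sub_apply]; ring
  have h0 : T.edgeVec 0 = -(T.edgeVec 1 + T.edgeVec 2) := by
    rw [← sub_eq_zero, ← T.edgeVec_sum]; abel
  apply mul_left_cancel₀ T.det_ne_zero
  have hs := sign_mul_self T.det
  have hD : ∀ x y z : ℝ, T.det * (-(Real.sign T.det * x) * I0 + -(Real.sign T.det * y) * I1 +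
      -(Real.sign T.det * z) * I2) = -(|T.det| * (x * I0 + y * I1 + z * I2)) := by
    intro x y z; rw [← hs]; ring
  rw [hD]
  simp only [cross, h0, PiLp.neg_apply, PiLp.add_apply]
  nth_rewrite 1 [hd]
  linear_combination (w 0 * T.edgeVec 2 1 - w 1 * T.edgeVec 2 0) * h1 +
    (T.edgeVec 1 0 * w 1 - T.edgeVec 1 1 * w 0) * h2

/-- The parallels to edge `i` shrink towards vertex `i`, where the weight `1 - t` degenerates.
Restricting to `t ≤ 1/2` keeps it above `1/2`, at the cost of the factor 2. -/
theorem integral_half_sq_le (i : Fin 3) {q : Poly} {p : ℕ} (g : ℝ → ℝ) (hg : Continuous g)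
    (h : ∀ t, g t ≤ (p + 1) ^ 2 * ∫ s in (0 : ℝ)..1,
      ev q (AffineMap.lineMap (AffineMap.lineMap (T.vert (i + 1)) (T.vert i) t : Plane)
        (AffineMap.lineMap (T.vert (i + 2)) (T.vert i) t) s) ^ 2) :
    |T.det| * ∫ t in (0 : ℝ)..(1 / 2), g t ≤ 2 * (p + 1) ^ 2 * ∫ z in T.opn, ev q z ^ 2 := by
  have hq := continuous_ev q
  set F : ℝ → ℝ := fun t => ∫ s in (0 : ℝ)..1,
      ev q (AffineMap.lineMap (AffineMap.lineMap (T.vert (i + 1)) (T.vert i) t : Plane)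
        (AffineMap.lineMap (T.vert (i + 2)) (T.vert i) t) s) ^ 2 with hF
  have hFc : Continuous F :=
    continuous_integral_lineMap (hq.pow 2) AffineMap.lineMap_continuous AffineMap.lineMap_continuous
  have hF0 : ∀ t, 0 ≤ F t := fun t =>
    intervalIntegral.integral_nonneg zero_le_one fun _ _ => sq_nonneg _
  have e : ∫ z in T.opn, ev q z ^ 2 = |T.det| * ∫ t in (0 : ℝ)..1, (1 - t) * F t :=
    T.integral_eq_iterated i (hq.pow 2)
  have hc1 : Continuous fun t => (1 - t) * F t := by fun_prop
  have h1 : ∫ t in (0 : ℝ)..(1 / 2), g t ≤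
      ∫ t in (0 : ℝ)..(1 / 2), 2 * (p + 1) ^ 2 * ((1 - t) * F t) := by
    refine intervalIntegral.integral_mono_on (by norm_num) (hg.intervalIntegrable _ _)
      ((hc1.const_mul _).intervalIntegrable _ _) fun t ht => (h t).trans ?_
    have : (0 : ℝ) ≤ (p + 1) ^ 2 * F t := mul_nonneg (by positivity) (hF0 t)
    have := ht.2
    change (p + 1) ^ 2 * F t ≤ _
    nlinarith
  have h2 : ∫ t in (0 : ℝ)..(1 / 2), (1 - t) * F t ≤ ∫ t in (0 : ℝ)..1, (1 - t) * F t := by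
    rw [← intervalIntegral.integral_add_adjacent_intervals (a := 0) (b := 1 / 2) (c := 1)
      (hc1.intervalIntegrable _ _) (hc1.intervalIntegrable _ _)]
    have : 0 ≤ ∫ t in (1 / 2 : ℝ)..1, (1 - t) * F t :=
      intervalIntegral.integral_nonneg (by norm_num) fun t ht =>
        mul_nonneg (by linarith [ht.2]) (hF0 t)
    linarith
  rw [intervalIntegral.integral_const_mul] at h1
  rw [e]
  have := abs_nonneg T.det
  calc _ ≤ |T.det| * (2 * (p + 1) ^ 2 * ∫ t in (0 : ℝ)..1, (1 - t) * F t) := by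
        refine mul_le_mul_of_nonneg_left (h1.trans ?_) this
        exact mul_le_mul_of_nonneg_left h2 (by positivity)
    _ = _ := by ring

/-- The inverse trace estimate on one edge. -/
theorem height_mul_edge_sq_le (k : Fin 3) {q : Poly} {p : ℕ} (hq : q.totalDegree ≤ p) :
    T.height k * (‖T.edgeVec k‖ * ∫ s in (0 : ℝ)..1,
      ev q (AffineMap.lineMap (T.vert (k + 1)) (T.vert (k + 2)) s) ^ 2) ≤
      4 * (p + 1) ^ 2 * ∫ z in T.opn, ev q z ^ 2 := by
  have hqc := continuous_ev q
  have hl : ∀ a b : Plane, Continuous fun s : ℝ => ev q (AffineMap.lineMap a b s) ^ 2 :=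
    fun a b => (hqc.comp AffineMap.lineMap_continuous).pow 2
  -- The two halves of edge `k` are reached by different families of segments ending on it:
  -- parallels to edge `k + 1` for the half near vertex `k + 2`, parallels to edge `k + 2` for the
  -- half near vertex `k + 1`.
  have h1 := T.integral_half_sq_le (k + 1) (q := q) (p := p)
    (fun t => ev q (AffineMap.lineMap (T.vert (k + 2)) (T.vert (k + 1)) t) ^ 2) (hl _ _) (fun t => by
      rw [fin_three_add_one_add_one, fin_three_add_one_add_two]
      exact ev_sq_le_integral _ _ hq)
  have h2 := T.integral_half_sq_le (k + 2) (q := q) (p := p)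
    (fun t => ev q (AffineMap.lineMap (T.vert (k + 1)) (T.vert (k + 2)) t) ^ 2) (hl _ _) (fun t => by
      rw [fin_three_add_two_add_one, fin_three_add_two_add_two]
      exact ev_sq_le_integral' _ _ hq)
  have h3 : ∫ s in (0 : ℝ)..(1 / 2), ev q (AffineMap.lineMap (T.vert (k + 2)) (T.vert (k + 1)) s) ^ 2
      = ∫ s in (1 / 2 : ℝ)..1, ev q (AffineMap.lineMap (T.vert (k + 1)) (T.vert (k + 2)) s) ^ 2 := by
    have := intervalIntegral.integral_comp_sub_left (a := 0) (b := 1 / 2)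
      (fun s => ev q (AffineMap.lineMap (T.vert (k + 1)) (T.vert (k + 2)) s) ^ 2) 1
    simp only [sub_zero, AffineMap.lineMap_apply_one_sub] at this
    rw [this]; norm_num
  rw [h3] at h1
  have h4 := intervalIntegral.integral_add_adjacent_intervals (a := 0) (b := 1 / 2) (c := 1)
    ((hl (T.vert (k + 1)) (T.vert (k + 2))).intervalIntegrable (μ := volume) _ _)
    ((hl (T.vert (k + 1)) (T.vert (k + 2))).intervalIntegrable _ _)
  have h5 : T.height k * ‖T.edgeVec k‖ = |T.det| := by
    rw [height, div_mul_cancel₀ _ (T.norm_edgeVec_pos k).ne']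
  rw [← mul_assoc, h5, ← h4]
  linarith

/-! ### Edge integrals with respect to arc length -/

open scoped Measure in
/-- The line integral as an integral with respect to the Hausdorff measure. -/
theorem integral_edge (i : Fin 3) (f : Plane → ℝ) :
    ∫ z in T.edge i, f z ∂(Measure.hausdorffMeasure 1) =
      ‖T.edgeVec i‖ * ∫ s in (0 : ℝ)..1,
        f (AffineMap.lineMap (T.vert (i + 1)) (T.vert (i + 2)) s) := by
  set ζ : ℝ → Plane := fun s => AffineMap.lineMap (T.vert (i + 1)) (T.vert (i + 2)) s with hζ
  have hζc : Continuous ζ := AffineMap.lineMap_continuous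
  have hinj : Function.Injective ζ :=
    AffineMap.lineMap_injective ℝ (T.vert_ne (fin_three_add_one_ne_add_two i))
  have hemb : MeasurableEmbedding ζ := hζc.measurableEmbedding hinj
  have hd : nndist (T.vert (i + 1)) (T.vert (i + 2)) = ‖T.edgeVec i‖₊ := by
    rw [nndist_comm, nndist_eq_nnnorm, edgeVec]
  have hm : (Measure.hausdorffMeasure 1 : Measure Plane).restrict (T.edge i) =
      ‖T.edgeVec i‖₊ • (volume.restrict (Set.Icc (0 : ℝ) 1)).map ζ := by
    ext s hs
    rw [Measure.restrict_apply hs, Measure.smul_apply, hemb.map_apply,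
      Measure.restrict_apply (hζc.measurable hs), edge, segment_eq_image_lineMap, Set.inter_comm,
      ← Set.image_inter_preimage, hausdorffMeasure_lineMap_image, hausdorffMeasure_real, hd,
      Set.inter_comm]
  rw [hm, integral_smul_nnreal_measure, hemb.integral_map, integral_Icc_eq_integral_Ioc,
    intervalIntegral.integral_of_le zero_le_one]
  rfl

end Triangle

/-- Arc length. -/
abbrev arc : Measure Plane := Measure.hausdorffMeasure 1

namespace Triangle

variable (T : Triangle)

theorem arc_edge_lt_top (i : Fin 3) : arc (T.edge i) < ⊤ := by
  rw [arc, edge, ← affineSegment_eq_segment, hausdorffMeasure_affineSegment]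
  exact edist_lt_top _ _

theorem integrableOn_edge (i : Fin 3) {f : Plane → ℝ} (hf : Continuous f) :
    IntegrableOn f (T.edge i) arc := by
  have : IsFiniteMeasure (arc.restrict (T.edge i)) := ⟨by simpa using T.arc_edge_lt_top i⟩
  obtain ⟨C, hC⟩ := (T.isCompact_edge i).exists_bound_of_continuousOn hf.continuousOn
  refine Integrable.of_bound hf.aestronglyMeasurable C ?_
  exact (ae_restrict_iff' (T.isCompact_edge i).measurableSet).2 (Filter.Eventually.of_forall hC)

/-- Edges of neighbouring triangles may overlap only in part. One measure on the plane, instead of a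
parametrisation of each edge, lets the densities from both sides be added pointwise. -/
theorem edgeIntegral_eq (i : Fin 3) (S : Set Plane) (f : Plane → ℝ) :
    T.edgeIntegral i S f = ∫ z in T.edge i, S.indicator f z ∂arc := by
  rw [arc, integral_edge]; rfl

/-- The divergence theorem for a polynomial on a triangle. -/
theorem integral_dx (q : Poly) :
    ∫ z in T.opn, ev (dx q) z = ∑ i, ∫ z in T.edge i, T.normal i 0 * ev q z ∂arc := by
  have h := T.integral_grad q !₂[1, 0]
  simp only [arc, integral_edge, intervalIntegral.integral_const_mul]
  simpa [inner_plane, mul_assoc] using h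

theorem integral_dy (q : Poly) :
    ∫ z in T.opn, ev (dy q) z = ∑ i, ∫ z in T.edge i, T.normal i 1 * ev q z ∂arc := by
  have h := T.integral_grad q !₂[0, 1]
  simp only [arc, integral_edge, intervalIntegral.integral_const_mul]
  simpa [inner_plane, mul_assoc] using h

/-- The inverse trace estimate for polynomials of degree `p` on a triangle that contains a disc
of radius comparable to its diameter. -/
theorem h_mul_sum_edge_sq_le {σ r : ℝ} {c : Plane} (hr : 0 < r)
    (hc : Metric.closedBall c r ⊆ T.closed) (hσ : T.h ≤ σ * r) {q : Poly} {p : ℕ} (hp : 1 ≤ p)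
    (hq : q.totalDegree ≤ p) :
    T.h / (24 * σ * p ^ 2) * ∑ i, ∫ z in T.edge i, ev q z ^ 2 ∂arc ≤ ∫ z in T.opn, ev q z ^ 2 := by
  have hσ0 : 0 < σ := pos_of_mul_pos_left (T.h_pos.trans_le hσ) hr.le
  have hp' : (1 : ℝ) ≤ p := by exact_mod_cast hp
  have hV : 0 ≤ ∫ z in T.opn, ev q z ^ 2 := integral_nonneg fun _ => sq_nonneg _
  -- The constant 8 is `σ / 2` (from `h ≤ σ r` and `2 r ≤ height`) times the 4 of the one-edge
  -- estimate times 4 from `(p + 1)² ≤ 4 p²`; the three edges make it 24.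
  have h1 : ∀ i, T.h * ∫ z in T.edge i, ev q z ^ 2 ∂arc ≤
      8 * σ * p ^ 2 * ∫ z in T.opn, ev q z ^ 2 := by
    intro i
    have h2 := T.height_mul_edge_sq_le i hq
    have h3 := T.integral_edge i (fun z => ev q z ^ 2)
    have h4 := T.two_mul_le_height hr hc i
    change ∫ z in T.edge i, ev q z ^ 2 ∂arc = _ at h3
    rw [← h3] at h2
    have hI : 0 ≤ ∫ z in T.edge i, ev q z ^ 2 ∂arc := integral_nonneg fun _ => sq_nonneg _
    have h5 : (p + 1 : ℝ) ^ 2 ≤ 4 * p ^ 2 := by nlinarith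
    calc _ ≤ (σ * r) * ∫ z in T.edge i, ev q z ^ 2 ∂arc := mul_le_mul_of_nonneg_right hσ hI
      _ = σ / 2 * ((2 * r) * ∫ z in T.edge i, ev q z ^ 2 ∂arc) := by ring
      _ ≤ σ / 2 * (T.height i * ∫ z in T.edge i, ev q z ^ 2 ∂arc) := by gcongr
      _ ≤ σ / 2 * (4 * (4 * p ^ 2) * ∫ z in T.opn, ev q z ^ 2) := by
        refine mul_le_mul_of_nonneg_left (h2.trans ?_) (by positivity)
        gcongr
      _ = _ := by ring
  have h6 : T.h * ∑ i, ∫ z in T.edge i, ev q z ^ 2 ∂arc ≤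
      24 * σ * p ^ 2 * ∫ z in T.opn, ev q z ^ 2 := by
    rw [Finset.mul_sum, Fin.sum_univ_three]
    linarith [h1 0, h1 1, h1 2]
  rw [div_mul_eq_mul_div, div_le_iff₀ (by positivity)]
  linarith

end Triangle

/-! ### Outward normals and adjacent triangles -/

theorem exists_pos_add_smul_mem_ball (z v : Plane) {r : ℝ} (hr : 0 < r) :
    ∃ δ : ℝ, 0 < δ ∧ z + δ • v ∈ Metric.ball z r := by
  have h : ContinuousAt (fun δ : ℝ => z + δ • v) 0 := by fun_prop
  have h1 : ∀ᶠ δ in nhds (0 : ℝ), z + δ • v ∈ Metric.ball z r :=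
    h (by simpa only [zero_smul, add_zero] using Metric.ball_mem_nhds z hr)
  obtain ⟨ε, hε, h2⟩ := Metric.eventually_nhds_iff_ball.1 h1
  exact ⟨ε / 2, by positivity, h2 _ (by simp [abs_of_pos hε, hε])⟩

theorem one_sub_inner_pos {m n : Plane} (hm : ‖m‖ = 1) (hn : ‖n‖ = 1) (h : m ≠ n) :
    0 < 1 - inner ℝ m n := by
  have h1 : 0 < ‖m - n‖ ^ 2 := by have := norm_pos_iff.2 (sub_ne_zero.2 h); positivity
  rw [norm_sub_sq_real, hm, hn] at h1
  linarith

theorem inner_self_of_norm_one {n : Plane} (hn : ‖n‖ = 1) : inner ℝ n n = (1 : ℝ) := by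
  rw [real_inner_self_eq_norm_sq, hn, one_pow]

namespace IsOutwardNormal

variable {Ω : Set Plane} {z n m : Plane}

theorem notMem (h : IsOutwardNormal Ω z n) : z ∉ Ω := by
  obtain ⟨-, r, hr, h⟩ := h
  rw [h z (Metric.mem_ball_self hr)]
  simp

/-- If `m ≠ n`, a small step along `m - n` is inside according to `n` and outside according to `m`.
-/
theorem unique (hn : IsOutwardNormal Ω z n) (hm : IsOutwardNormal Ω z m) : m = n := by
  obtain ⟨hn1, r, hr, hn⟩ := hn
  obtain ⟨hm1, s, hs, hm⟩ := hm
  by_contra hne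
  obtain ⟨δ, hδ, hw⟩ := exists_pos_add_smul_mem_ball z (m - n) (lt_min hr hs)
  have h1 := hn _ (Metric.ball_subset_ball (min_le_left _ _) hw)
  have h2 := hm _ (Metric.ball_subset_ball (min_le_right _ _) hw)
  have h3 := one_sub_inner_pos hm1 hn1 hne
  rw [h1] at h2
  rw [add_sub_cancel_left, inner_smul_left, inner_smul_left, inner_sub_left, inner_sub_left,
    inner_self_of_norm_one hn1, inner_self_of_norm_one hm1, real_inner_comm m n] at h2
  simp only [conj_trivial] at h2
  have h4 : δ * (inner ℝ m n - 1) < 0 := mul_neg_of_pos_of_neg hδ (by linarith)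
  have h5 : 0 < δ * (1 - inner ℝ m n) := mul_pos hδ h3
  linarith [h2.1 h4]

theorem mem_closure (h : IsOutwardNormal Ω z n) : z ∈ closure Ω := by
  obtain ⟨hn, r, hr, h⟩ := h
  rw [Metric.mem_closure_iff]
  intro ε hε
  obtain ⟨δ, hδ, hw⟩ := exists_pos_add_smul_mem_ball z (-n) (lt_min hr hε)
  refine ⟨_, (h _ (Metric.ball_subset_ball (min_le_left _ _) hw)).2 ?_, ?_⟩
  · rw [add_sub_cancel_left, inner_smul_left, inner_neg_left, inner_self_of_norm_one hn]
    simpa using hδ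
  · rw [dist_comm]; exact Metric.ball_subset_ball (min_le_right _ _) hw

end IsOutwardNormal

theorem mem_inflowBoundary_iff {Ω : Set Plane} {z n : Plane} (h : IsOutwardNormal Ω z n) :
    z ∈ inflowBoundary Ω ↔ n 0 = 0 ∧ z 0 * n 1 < 0 :=
  ⟨fun ⟨_, hm, h'⟩ => h.unique hm ▸ h', fun h' => ⟨n, h, h'⟩⟩

theorem mem_ellipticBoundary_iff {Ω : Set Plane} {z n : Plane} (h : IsOutwardNormal Ω z n) :
    z ∈ ellipticBoundary Ω ↔ n 0 ≠ 0 :=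
  ⟨fun ⟨_, hm, h'⟩ => h.unique hm ▸ h', fun h' => ⟨n, h, h'⟩⟩

theorem notMem_of_mem_inflowBoundary {Ω : Set Plane} {z : Plane} (h : z ∈ inflowBoundary Ω) :
    z ∉ Ω := by
  obtain ⟨n, hn, -⟩ := h
  exact hn.notMem

theorem notMem_of_mem_ellipticBoundary {Ω : Set Plane} {z : Plane} (h : z ∈ ellipticBoundary Ω) :
    z ∉ Ω := by
  obtain ⟨n, hn, -⟩ := h
  exact hn.notMem

namespace Triangle

theorem inner_edgeVec_normal (T : Triangle) (i : Fin 3) :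
    inner ℝ (T.edgeVec i) (T.normal i) = (0 : ℝ) := by
  have h := T.norm_edgeVec_mul_inner_normal i (T.edgeVec i)
  have : cross (T.edgeVec i) (T.edgeVec i) = 0 := by simp [cross]; ring
  rw [this, mul_zero, neg_zero] at h
  exact (mul_eq_zero.1 h).resolve_left (T.norm_edgeVec_pos i).ne'

variable {T T' : Triangle} {z : Plane} {i i' : Fin 3}

theorem notMem_opn_of_disjoint (h : Disjoint T.opn T'.opn) (hz : z ∈ T'.closed) : z ∉ T.opn := by
  intro hzo
  obtain ⟨w, hw, hw'⟩ := mem_closure_iff.1 (T'.closed_subset_closure_opn hz) _ T.isOpen_opn hzo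
  exact Set.disjoint_left.1 h hw hw'

/-- Unless the normals are opposite, a small step against their sum enters both open triangles. -/
theorem normal_eq_neg_of_disjoint (h : Disjoint T.opn T'.opn) (hz : z ∈ T.edge i)
    (hz' : z ∈ T'.edge i') (hv : z ∉ T.vertices) (hv' : z ∉ T'.vertices) :
    T'.normal i' = -T.normal i := by
  obtain ⟨r, hr, hT⟩ := T.exists_ball_of_mem_edge hz hv
  obtain ⟨s, hs, hT'⟩ := T'.exists_ball_of_mem_edge hz' hv'
  by_contra hne
  have hn : ‖-T.normal i‖ = 1 := by rw [norm_neg, T.norm_normal]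
  have h3 := one_sub_inner_pos (T'.norm_normal i') hn hne
  obtain ⟨δ, hδ, hw⟩ := exists_pos_add_smul_mem_ball z (-(T.normal i + T'.normal i')) (lt_min hr hs)
  have h1 := (hT _ (Metric.ball_subset_ball (min_le_left _ _) hw)).1
  have h2 := (hT' _ (Metric.ball_subset_ball (min_le_right _ _) hw)).1
  rw [add_sub_cancel_left, inner_smul_left, inner_neg_left, inner_add_left,
    inner_self_of_norm_one (T.norm_normal i)] at h1
  rw [add_sub_cancel_left, inner_smul_left, inner_neg_left, inner_add_left,
    inner_self_of_norm_one (T'.norm_normal i'), real_inner_comm] at h2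
  rw [inner_neg_right] at h3
  simp only [conj_trivial] at h1 h2
  have h4 : δ * (1 + inner ℝ (T'.normal i') (T.normal i)) > 0 := mul_pos hδ (by linarith)
  exact Set.disjoint_left.1 h (h1.2 (by linarith)) (h2.2 (by linarith))

/-- A small step along the common edge direction stays in both closed triangles. This is what makes
local quasi-uniformity applicable to the two sides of an interface. -/
theorem nontrivial_inter_of_normal_eq_neg (hz : z ∈ T.edge i)
    (hz' : z ∈ T'.edge i') (hv : z ∉ T.vertices) (hv' : z ∉ T'.vertices)
    (hn : T'.normal i' = -T.normal i) : (T.closed ∩ T'.closed).Nontrivial := by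
  obtain ⟨r, hr, hT⟩ := T.exists_ball_of_mem_edge hz hv
  obtain ⟨s, hs, hT'⟩ := T'.exists_ball_of_mem_edge hz' hv'
  obtain ⟨δ, hδ, hw⟩ := exists_pos_add_smul_mem_ball z (T.edgeVec i) (lt_min hr hs)
  have h1 := (hT _ (Metric.ball_subset_ball (min_le_left _ _) hw)).2
  have h2 := (hT' _ (Metric.ball_subset_ball (min_le_right _ _) hw)).2
  rw [add_sub_cancel_left, inner_smul_left] at h1 h2
  rw [hn, inner_neg_right] at h2
  rw [T.inner_edgeVec_normal] at h1 h2
  refine ⟨z, ⟨T.edge_subset_closed i hz, T'.edge_subset_closed i' hz'⟩, _,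
    ⟨h1.2 (by simp), h2.2 (by simp)⟩, ?_⟩
  intro e
  have : δ • T.edgeVec i = 0 := by simpa using e.symm
  rcases smul_eq_zero.1 this with h | h
  · exact hδ.ne' h
  · exact T.edgeVec_ne_zero i h

theorem closed_union_mem_nhds (hz : z ∈ T.edge i)
    (hz' : z ∈ T'.edge i') (hv : z ∉ T.vertices) (hv' : z ∉ T'.vertices)
    (hn : T'.normal i' = -T.normal i) : T.closed ∪ T'.closed ∈ nhds z := by
  obtain ⟨r, hr, hT⟩ := T.exists_ball_of_mem_edge hz hv
  obtain ⟨s, hs, hT'⟩ := T'.exists_ball_of_mem_edge hz' hv'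
  refine Metric.mem_nhds_iff.2 ⟨min r s, lt_min hr hs, fun w hw => ?_⟩
  have h1 := (hT _ (Metric.ball_subset_ball (min_le_left _ _) hw)).2
  have h2 := (hT' _ (Metric.ball_subset_ball (min_le_right _ _) hw)).2
  rw [hn, inner_neg_right] at h2
  rcases le_total (inner ℝ (w - z) (T.normal i)) 0 with h | h
  · exact Or.inl (h1.2 h)
  · exact Or.inr (h2.2 (by linarith))

end Triangle

/-- A regular open set whose closure is locally a closed half plane is locally an open one. -/
theorem isOutwardNormal_of_closure {Ω : Set Plane} (hΩ : interior (closure Ω) = Ω) {z n : Plane}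
    (hn : ‖n‖ = 1) {r : ℝ} (hr : 0 < r)
    (h : ∀ w ∈ Metric.ball z r, (w ∈ closure Ω ↔ inner ℝ (w - z) n ≤ 0)) :
    IsOutwardNormal Ω z n := by
  refine ⟨hn, r, hr, fun w hw => ⟨fun hwΩ => ?_, fun hlt => ?_⟩⟩
  · by_contra hge
    have hw0 : inner ℝ (w - z) n = (0 : ℝ) :=
      le_antisymm ((h w hw).1 (subset_closure hwΩ)) (not_lt.1 hge)
    rw [← hΩ, mem_interior_iff_mem_nhds, Metric.mem_nhds_iff] at hwΩ
    obtain ⟨s, hs, hsub⟩ := hwΩ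
    obtain ⟨t, ht, htsub⟩ := Metric.isOpen_iff.1 Metric.isOpen_ball w hw
    -- A point of `Ω` on the boundary line could be pushed along `n` without leaving the closure,
    -- although that leaves the closed half plane.
    obtain ⟨δ, hδ, hu⟩ := exists_pos_add_smul_mem_ball w n (lt_min hs ht)
    have h1 := (h _ (htsub (Metric.ball_subset_ball (min_le_right _ _) hu))).1
      (hsub (Metric.ball_subset_ball (min_le_left _ _) hu))
    rw [add_sub_right_comm, inner_add_left, hw0, inner_smul_left, inner_self_of_norm_one hn] at h1
    simp at h1
    linarith
  · rw [← hΩ, mem_interior]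
    refine ⟨Metric.ball z r ∩ {w | inner ℝ (w - z) n < 0}, fun u hu => ?_, ?_, hw, hlt⟩
    · exact (h u hu.1).2 (le_of_lt hu.2)
    · exact Metric.isOpen_ball.inter (isOpen_lt (by fun_prop) continuous_const)

/-! ### Interface points and boundary points of a triangulation -/

namespace Triangulation

variable {Ω : Set Plane} (𝒯 : Triangulation Ω)

/-- The set of the vertices of the triangles. -/
def vertices : Set Plane := ⋃ j, (𝒯.tri j).vertices

theorem finite_vertices : 𝒯.vertices.Finite :=
  Set.finite_iUnion fun _ => Set.finite_range _

variable {𝒯}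

theorem notMem_vertices {z : Plane} (h : z ∉ 𝒯.vertices) (j : Fin 𝒯.n) :
    z ∉ (𝒯.tri j).vertices := fun h' => h (Set.mem_iUnion.2 ⟨j, h'⟩)

variable (𝒯) in
/-- `z` is a point of an interface between the edges `i` of `T_j` and `i'` of `T_k`. -/
structure IsInterfacePoint (z : Plane) (j : Fin 𝒯.n) (i : Fin 3) (k : Fin 𝒯.n) (i' : Fin 3) :
    Prop where
  ne : j ≠ k
  mem_left : z ∈ (𝒯.tri j).edge i
  mem_right : z ∈ (𝒯.tri k).edge i'
  normal_eq : (𝒯.tri k).normal i' = -(𝒯.tri j).normal i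
  mem : z ∈ Ω
  eq_or_eq : ∀ l, z ∈ (𝒯.tri l).closed → l = j ∨ l = k
  nontrivial : ((𝒯.tri j).closed ∩ (𝒯.tri k).closed).Nontrivial

variable (𝒯) in
/-- `z` is a point of `∂Ω` on the edge `i` of `T_j`. -/
structure IsBoundaryPoint (z : Plane) (j : Fin 𝒯.n) (i : Fin 3) : Prop where
  mem_edge : z ∈ (𝒯.tri j).edge i
  normal : IsOutwardNormal Ω z ((𝒯.tri j).normal i)
  eq : ∀ l, z ∈ (𝒯.tri l).closed → l = j

theorem exists_mem_edge_of_mem_closed {z : Plane} {j k : Fin 𝒯.n} (hjk : j ≠ k)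
    (hj : z ∈ (𝒯.tri j).closed) (hk : z ∈ (𝒯.tri k).closed) : ∃ i, z ∈ (𝒯.tri j).edge i :=
  ((𝒯.tri j).mem_opn_or_mem_edge hj).resolve_left
    (Triangle.notMem_opn_of_disjoint (𝒯.disjoint j k hjk) hk)

theorem closed_subset_closure (j : Fin 𝒯.n) : (𝒯.tri j).closed ⊆ closure Ω := by
  rw [← 𝒯.cover]; exact Set.subset_iUnion (fun j => (𝒯.tri j).closed) j

theorem IsInterfacePoint.symm {z : Plane} {j k : Fin 𝒯.n} {i i' : Fin 3}
    (h : 𝒯.IsInterfacePoint z j i k i') : 𝒯.IsInterfacePoint z k i' j i :=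
  ⟨h.ne.symm, h.mem_right, h.mem_left, by rw [h.normal_eq, neg_neg], h.mem,
    fun l hl => (h.eq_or_eq l hl).symm, by rw [Set.inter_comm]; exact h.nontrivial⟩

/-- Each point of an edge which is not a vertex lies on exactly one interface or on the
smooth part of the boundary. -/
theorem isInterfacePoint_or_isBoundaryPoint (hΩ : interior (closure Ω) = Ω) {z : Plane}
    (hz : z ∉ 𝒯.vertices) {j : Fin 𝒯.n} {i : Fin 3} (hj : z ∈ (𝒯.tri j).edge i) :
    (∃ k i', 𝒯.IsInterfacePoint z j i k i') ∨ 𝒯.IsBoundaryPoint z j i := by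
  have hjc := (𝒯.tri j).edge_subset_closed i hj
  by_cases hk : ∃ k, k ≠ j ∧ z ∈ (𝒯.tri k).closed
  · left
    obtain ⟨k, hkj, hkc⟩ := hk
    obtain ⟨i', hi'⟩ := exists_mem_edge_of_mem_closed hkj hkc hjc
    have hn := Triangle.normal_eq_neg_of_disjoint (𝒯.disjoint j k hkj.symm) hj hi'
      (notMem_vertices hz j) (notMem_vertices hz k)
    refine ⟨k, i', hkj.symm, hj, hi', hn, ?_, fun l hl => ?_,
      Triangle.nontrivial_inter_of_normal_eq_neg hj hi' (notMem_vertices hz j)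
      (notMem_vertices hz k) hn⟩
    · refine hΩ.subset (mem_interior_iff_mem_nhds.2 ?_)
      exact Filter.mem_of_superset (Triangle.closed_union_mem_nhds hj hi' (notMem_vertices hz j)
        (notMem_vertices hz k) hn)
        (Set.union_subset (closed_subset_closure j) (closed_subset_closure k))
    -- A third triangle at `z` would have its normal opposite to both `n` and `-n`, forcing `n = 0`.
    · by_contra! hne
      obtain ⟨i'', hi''⟩ := exists_mem_edge_of_mem_closed hne.1 hl hjc
      have h1 := Triangle.normal_eq_neg_of_disjoint (𝒯.disjoint j l hne.1.symm) hj hi''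
        (notMem_vertices hz j) (notMem_vertices hz l)
      have h2 := Triangle.normal_eq_neg_of_disjoint (𝒯.disjoint k l hne.2.symm) hi' hi''
        (notMem_vertices hz k) (notMem_vertices hz l)
      rw [h1, hn, neg_neg, neg_eq_iff_add_eq_zero, ← two_smul ℝ, smul_eq_zero] at h2
      have h3 := (𝒯.tri j).norm_normal i
      rw [h2.resolve_left two_ne_zero, norm_zero] at h3
      exact zero_ne_one h3
  · right
    push Not at hk
    refine ⟨hj, ?_, fun l hl => by_contra fun hne => hk l hne hl⟩
    obtain ⟨r, hr, hT⟩ := (𝒯.tri j).exists_ball_of_mem_edge hj (notMem_vertices hz j)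
    have hev : ∀ᶠ w in nhds z, ∀ k, k ≠ j → w ∉ (𝒯.tri k).closed := by
      rw [Filter.eventually_all]
      intro k
      by_cases hkj : k = j
      · simp [hkj]
      · filter_upwards [(𝒯.tri k).isClosed_closed.isOpen_compl.mem_nhds (hk k hkj)] with w hw _
          using hw
    obtain ⟨s, hs, hev⟩ := Metric.eventually_nhds_iff_ball.1 hev
    refine isOutwardNormal_of_closure hΩ ((𝒯.tri j).norm_normal i) (lt_min hr hs) fun w hw => ?_
    rw [← (hT w (Metric.ball_subset_ball (min_le_left _ _) hw)).2, ← 𝒯.cover, Set.mem_iUnion]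
    refine ⟨fun ⟨k, hk⟩ => ?_, fun h => ⟨j, h⟩⟩
    by_cases hkj : k = j
    · exact hkj ▸ hk
    · exact absurd hk (hev w (Metric.ball_subset_ball (min_le_right _ _) hw) k hkj)

theorem opn_subset (hΩ : interior (closure Ω) = Ω) (j : Fin 𝒯.n) : (𝒯.tri j).opn ⊆ Ω := by
  exact (interior_mono (closed_subset_closure j)).trans hΩ.subset

/-- The normals of the elliptic boundary are bounded away from the vertical direction. -/
theorem exists_pos_le_normal_sq (hΩ : interior (closure Ω) = Ω) (𝒯 : Triangulation Ω) :
    ∃ c > 0, ∀ z n, z ∉ 𝒯.vertices → IsOutwardNormal Ω z n → n 0 ≠ 0 → c ≤ n 0 ^ 2 := by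
  -- Every boundary point off the vertices has the normal of one of finitely many edges, so a
  -- positive minimum exists.
  have h1 : ∃ c > (0 : ℝ), ∀ a : Fin 𝒯.n × Fin 3, (𝒯.tri a.1).normal a.2 0 ≠ 0 →
      c ≤ (𝒯.tri a.1).normal a.2 0 ^ 2 := by
    have : ∀ s : Finset (Fin 𝒯.n × Fin 3), ∃ c > (0 : ℝ), ∀ a ∈ s, (𝒯.tri a.1).normal a.2 0 ≠ 0 →
        c ≤ (𝒯.tri a.1).normal a.2 0 ^ 2 := by
      intro s
      induction s using Finset.induction_on with
      | empty => exact ⟨1, one_pos, by simp⟩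
      | insert a s _ ih =>
        obtain ⟨c, hc, h⟩ := ih
        by_cases ha : (𝒯.tri a.1).normal a.2 0 = 0
        · refine ⟨c, hc, fun b hb hb0 => ?_⟩
          rcases Finset.mem_insert.1 hb with rfl | hb
          · exact absurd ha hb0
          · exact h b hb hb0
        · refine ⟨min c ((𝒯.tri a.1).normal a.2 0 ^ 2), lt_min hc (by positivity),
            fun b hb hb0 => ?_⟩
          rcases Finset.mem_insert.1 hb with rfl | hb
          · exact min_le_right _ _
          · exact (min_le_left _ _).trans (h b hb hb0)
    obtain ⟨c, hc, h⟩ := this Finset.univ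
    exact ⟨c, hc, fun a => h a (Finset.mem_univ a)⟩
  obtain ⟨c, hc, h⟩ := h1
  refine ⟨c, hc, fun z n hz hn hn0 => ?_⟩
  have hzc := hn.mem_closure
  rw [← 𝒯.cover, Set.mem_iUnion] at hzc
  obtain ⟨j, hj⟩ := hzc
  rcases (𝒯.tri j).mem_opn_or_mem_edge hj with ho | ⟨i, hi⟩
  · exact absurd (opn_subset hΩ j ho) hn.notMem
  · rcases isInterfacePoint_or_isBoundaryPoint hΩ hz hi with ⟨k, i', hI⟩ | hB
    · exact absurd hI.mem hn.notMem
    · have e := hn.unique hB.normal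
      rw [← e] at hn0 ⊢
      exact h (j, i) hn0

end Triangulation

/-! ### Integrals over the skeleton -/

theorem arc_finite {N : Set Plane} (hN : N.Finite) : arc N = 0 := by
  have : NullSingletonClass arc := Measure.nullSingletonClass_hausdorff Plane one_pos
  exact hN.measure_zero arc

namespace Triangulation

variable {Ω : Set Plane} {𝒯 : Triangulation Ω}

theorem sum_indicator_edge_of_isInterfacePoint {z : Plane} (hz : z ∉ 𝒯.vertices)
    {j k : Fin 𝒯.n} {i i' : Fin 3} (h : 𝒯.IsInterfacePoint z j i k i')
    (Φ : Fin 𝒯.n → Fin 3 → Plane → ℝ) :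
    ∑ l, ∑ m, ((𝒯.tri l).edge m).indicator (Φ l m) z = Φ j i z + Φ k i' z := by
  have aux : ∀ {l : Fin 𝒯.n} {m : Fin 3}, z ∈ (𝒯.tri l).edge m →
      ∑ m, ((𝒯.tri l).edge m).indicator (Φ l m) z = Φ l m z := by
    intro l m hm
    rw [Finset.sum_eq_single m, Set.indicator_of_mem hm]
    · intro b _ hb
      exact Set.indicator_of_notMem (fun h' => hb ((𝒯.tri l).edge_unique h' hm
        (notMem_vertices hz l))) _
    · simp
  rw [Finset.sum_eq_add j k h.ne, aux h.mem_left, aux h.mem_right]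
  · intro l _ hl
    refine Finset.sum_eq_zero fun m _ => Set.indicator_of_notMem (fun h' => ?_) _
    rcases h.eq_or_eq l ((𝒯.tri l).edge_subset_closed m h') with e | e
    · exact hl.1 e
    · exact hl.2 e
  · simp
  · simp

theorem sum_indicator_edge_of_isBoundaryPoint {z : Plane} (hz : z ∉ 𝒯.vertices)
    {j : Fin 𝒯.n} {i : Fin 3} (h : 𝒯.IsBoundaryPoint z j i)
    (Φ : Fin 𝒯.n → Fin 3 → Plane → ℝ) :
    ∑ l, ∑ m, ((𝒯.tri l).edge m).indicator (Φ l m) z = Φ j i z := by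
  rw [Finset.sum_eq_single j, Finset.sum_eq_single i, Set.indicator_of_mem h.mem_edge]
  · intro b _ hb
    exact Set.indicator_of_notMem (fun h' => hb ((𝒯.tri j).edge_unique h' h.mem_edge
      (notMem_vertices hz j))) _
  · simp
  · intro l _ hl
    exact Finset.sum_eq_zero fun m _ => Set.indicator_of_notMem
      (fun h' => hl (h.eq l ((𝒯.tri l).edge_subset_closed m h'))) _
  · simp

/-- A sum of edge integrals is nonnegative if the densities are so, after adding
those of the two sides of each interface. -/
theorem sum_integral_edge_nonneg (hΩ : interior (closure Ω) = Ω)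
    (Φ : Fin 𝒯.n → Fin 3 → Plane → ℝ)
    (hΦ : ∀ j i, IntegrableOn (Φ j i) ((𝒯.tri j).edge i) arc) {N : Set Plane} (hN : N.Finite)
    (hI : ∀ z j i k i', z ∉ N → 𝒯.IsInterfacePoint z j i k i' → j < k → 0 ≤ Φ j i z + Φ k i' z)
    (hB : ∀ z j i, z ∉ N → 𝒯.IsBoundaryPoint z j i → 0 ≤ Φ j i z) :
    0 ≤ ∑ j, ∑ i, ∫ z in (𝒯.tri j).edge i, Φ j i z ∂arc := by
  have hm : ∀ j i, MeasurableSet ((𝒯.tri j).edge i) :=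
    fun j i => ((𝒯.tri j).isCompact_edge i).measurableSet
  have hint : ∀ j i, Integrable (((𝒯.tri j).edge i).indicator (Φ j i)) arc :=
    fun j i => (integrable_indicator_iff (hm j i)).2 (hΦ j i)
  simp only [← integral_indicator (hm _ _)]
  rw [Finset.sum_congr rfl fun j _ => (integral_finsetSum _ fun i _ => hint j i).symm,
    ← integral_finsetSum _ fun j _ => integrable_finsetSum _ fun i _ => hint j i]
  -- Under one integral the sum can be examined pointwise: off a finite set, a point of the skeleton
  -- lies on the two edges of one interface or on a single boundary edge, so at most two indicators
  -- survive.
  refine integral_nonneg_of_ae ?_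
  have hnull : arc (N ∪ 𝒯.vertices) = 0 := arc_finite (hN.union 𝒯.finite_vertices)
  filter_upwards [compl_mem_ae_iff.2 hnull] with z hz
  have hzN : z ∉ N := fun h => hz (Or.inl h)
  have hzv : z ∉ 𝒯.vertices := fun h => hz (Or.inr h)
  by_cases he : ∃ j i, z ∈ (𝒯.tri j).edge i
  · obtain ⟨j, i, hji⟩ := he
    rcases isInterfacePoint_or_isBoundaryPoint hΩ hzv hji with ⟨k, i', h⟩ | h
    · change 0 ≤ ∑ l, ∑ m, ((𝒯.tri l).edge m).indicator (Φ l m) z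
      rw [sum_indicator_edge_of_isInterfacePoint hzv h]
      rcases h.ne.lt_or_gt with hlt | hlt
      · exact hI z j i k i' hzN h hlt
      · rw [add_comm]; exact hI z k i' j i hzN h.symm hlt
    · change 0 ≤ ∑ l, ∑ m, ((𝒯.tri l).edge m).indicator (Φ l m) z
      rw [sum_indicator_edge_of_isBoundaryPoint hzv h]
      exact hB z j i hzN h
  · push Not at he
    refine Finset.sum_nonneg fun j _ => Finset.sum_nonneg fun i _ => ?_
    rw [Set.indicator_of_notMem (he j i)]

theorem ae_edge_notMem_vertices (𝒯 : Triangulation Ω) (j : Fin 𝒯.n) (i : Fin 3) :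
    ∀ᵐ z ∂arc.restrict ((𝒯.tri j).edge i), z ∈ (𝒯.tri j).edge i ∧ z ∉ 𝒯.vertices := by
  rw [ae_restrict_iff' ((𝒯.tri j).isCompact_edge i).measurableSet]
  filter_upwards [compl_mem_ae_iff.2 (arc_finite 𝒯.finite_vertices)] with z hz hz'
  exact ⟨hz', hz⟩

/-- Measurability of the inflow boundary as a whole is not needed: almost everywhere on a fixed edge
it coincides with the part outside `Ω` where the fixed edge normal satisfies the inflow condition,
and that set is plainly measurable. -/
theorem integrableOn_indicator_inflowBoundary (hΩ : interior (closure Ω) = Ω) (j : Fin 𝒯.n)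
    (i : Fin 3) {f : Plane → ℝ} (hf : Continuous f) :
    IntegrableOn ((inflowBoundary Ω).indicator f) ((𝒯.tri j).edge i) arc := by
  have hΩo : IsOpen Ω := hΩ ▸ isOpen_interior
  set n := (𝒯.tri j).normal i
  have hS : MeasurableSet (Ωᶜ ∩ {z : Plane | n 0 = 0 ∧ z 0 * n 1 < 0}) := by
    refine hΩo.isClosed_compl.measurableSet.inter (MeasurableSet.inter (MeasurableSet.const _) ?_)
    exact (isOpen_lt (f := fun z : Plane => z 0 * n 1) (by fun_prop)
      continuous_const).measurableSet
  refine (((𝒯.tri j).integrableOn_edge i hf).indicator hS).congr ?_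
  filter_upwards [ae_edge_notMem_vertices 𝒯 j i] with z hz
  by_cases hzΩ : z ∈ Ω
  · rw [Set.indicator_of_notMem (fun h => h.1 hzΩ),
      Set.indicator_of_notMem (fun h => notMem_of_mem_inflowBoundary h hzΩ)]
  · rcases isInterfacePoint_or_isBoundaryPoint hΩ hz.2 hz.1 with ⟨k, i', h⟩ | h
    · exact absurd h.mem hzΩ
    · have h1 := mem_inflowBoundary_iff h.normal
      by_cases h2 : z ∈ inflowBoundary Ω
      · have hm : z ∈ Ωᶜ ∩ {z : Plane | n 0 = 0 ∧ z 0 * n 1 < 0} := ⟨hzΩ, h1.1 h2⟩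
        rw [Set.indicator_of_mem h2, Set.indicator_of_mem hm]
      · rw [Set.indicator_of_notMem h2, Set.indicator_of_notMem (fun h' => h2 (h1.2 h'.2))]

theorem integrableOn_indicator_ellipticBoundary (hΩ : interior (closure Ω) = Ω) (j : Fin 𝒯.n)
    (i : Fin 3) {f : Plane → ℝ} (hf : Continuous f) :
    IntegrableOn ((ellipticBoundary Ω).indicator f) ((𝒯.tri j).edge i) arc := by
  have hΩo : IsOpen Ω := hΩ ▸ isOpen_interior
  set n := (𝒯.tri j).normal i
  have hS : MeasurableSet (Ωᶜ ∩ {z : Plane | n 0 ≠ 0}) :=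
    hΩo.isClosed_compl.measurableSet.inter (MeasurableSet.const _)
  refine (((𝒯.tri j).integrableOn_edge i hf).indicator hS).congr ?_
  filter_upwards [ae_edge_notMem_vertices 𝒯 j i] with z hz
  by_cases hzΩ : z ∈ Ω
  · rw [Set.indicator_of_notMem (fun h => h.1 hzΩ),
      Set.indicator_of_notMem (fun h => notMem_of_mem_ellipticBoundary h hzΩ)]
  · rcases isInterfacePoint_or_isBoundaryPoint hΩ hz.2 hz.1 with ⟨k, i', h⟩ | h
    · exact absurd h.mem hzΩ
    · have h1 := mem_ellipticBoundary_iff h.normal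
      by_cases h2 : z ∈ ellipticBoundary Ω
      · have hm : z ∈ Ωᶜ ∩ {z : Plane | n 0 ≠ 0} := ⟨hzΩ, h1.1 h2⟩
        rw [Set.indicator_of_mem h2, Set.indicator_of_mem hm]
      · rw [Set.indicator_of_notMem h2, Set.indicator_of_notMem (fun h' => h2 (h1.2 h'.2))]

theorem integrableOn_indicator_closed_inter (hΩ : interior (closure Ω) = Ω) (j k : Fin 𝒯.n)
    (i : Fin 3) {f : Plane → ℝ} (hf : Continuous f) :
    IntegrableOn (((𝒯.tri k).closed ∩ Ω).indicator f) ((𝒯.tri j).edge i) arc := by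
  have hΩo : IsOpen Ω := hΩ ▸ isOpen_interior
  exact ((𝒯.tri j).integrableOn_edge i hf).indicator
    ((𝒯.tri k).isClosed_closed.measurableSet.inter hΩo.measurableSet)

/-! ### The Poincaré–Friedrichs inequality -/

theorem isBounded_closure (𝒯 : Triangulation Ω) : Bornology.IsBounded (closure Ω) := by
  rw [← 𝒯.cover, Bornology.isBounded_iUnion]
  exact fun j => (𝒯.tri j).isCompact_closed.isBounded

/-- The boundary values of functions in `V_h` do not contribute to `∫ (x V²)_x`. -/
theorem sum_integral_dx_sq_nonneg (hΩ : interior (closure Ω) = Ω) {p : ℕ} {V : 𝒯.PW}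
    (hV : V ∈ 𝒯.feSpace p) (c : ℝ) :
    0 ≤ ∑ j, ∫ z in (𝒯.tri j).opn,
      ev (dx (MvPolynomial.C c * (MvPolynomial.X 0 * V j ^ 2))) z := by
  obtain ⟨-, hV2, hV3⟩ := hV
  simp only [Triangle.integral_dx]
  refine sum_integral_edge_nonneg hΩ _ (fun j i => ?_) Set.finite_empty ?_ ?_
  · have := continuous_ev (MvPolynomial.C c * (MvPolynomial.X 0 * V j ^ 2))
    exact (𝒯.tri j).integrableOn_edge i (by fun_prop)
  · intro z j i k i' _ h _
    have e := hV2 j k z ⟨(𝒯.tri j).edge_subset_closed i h.mem_left,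
      (𝒯.tri k).edge_subset_closed i' h.mem_right⟩
    rw [h.normal_eq]
    simp [e]
  · intro z j i _ h
    by_cases h0 : (𝒯.tri j).normal i 0 = 0
    · simp [h0]
    · have e := hV3 j z ⟨(𝒯.tri j).edge_subset_closed i h.mem_edge,
        Or.inr ((mem_ellipticBoundary_iff h.normal).2 h0)⟩
      simp [e]

theorem dx_C_mul_X_mul_sq (c : ℝ) (q : Poly) (z : Plane) :
    ev (dx (MvPolynomial.C c * (MvPolynomial.X 0 * q ^ 2))) z =
      c * (ev q z ^ 2 + 2 * (z 0 * ev q z * ev (dx q) z)) := by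
  have h : dx (MvPolynomial.C c * (MvPolynomial.X 0 * q ^ 2)) =
      MvPolynomial.C c * (q * q + MvPolynomial.X 0 * (dx q * q + q * dx q)) := by
    rw [pow_two, dx_mul, dx_mul, dx_mul]
    simp [dx]
  rw [h]
  simp only [ev_mul, ev_add, ev_C, ev_X]
  ring

theorem dotProduct_one_grad (q : Poly) (z : Plane) :
    grad q z ⬝ᵥ (1 : Matrix (Fin 2) (Fin 2) ℝ) *ᵥ grad q z = ev (dx q) z ^ 2 + ev (dy q) z ^ 2 := by
  simp [grad, dotProduct, Fin.sum_univ_two]; ring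

theorem exists_isPoincareConstant (hΩ : interior (closure Ω) = Ω) :
    ∃ C : ℝ, IsPoincareConstant Ω C := by
  -- The existence of a triangulation is what makes `Ω` bounded; without one there is nothing to
  -- estimate.
  by_cases hne : Nonempty (Triangulation Ω)
  · obtain ⟨𝒯₀⟩ := hne
    obtain ⟨R, hR0, hR⟩ := 𝒯₀.isBounded_closure.exists_pos_norm_le
    refine ⟨4 * R ^ 2, by positivity, fun 𝒯 p V hV => ?_⟩
    -- With factor `-2` the density is `-2V² - 4xVV_x`. It is at most `4R²|∇V|² - V²`, because `(V +
    -- 2xV_x)² ≥ 0` and `x² ≤ R²`; hence the constant `4R²`.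
    have h1 := sum_integral_dx_sq_nonneg hΩ hV (-2)
    unfold l2 energy
    suffices 0 ≤ ∑ j, ∫ z in (𝒯.tri j).opn, (4 * R ^ 2 *
        (grad (V j) z ⬝ᵥ (1 : Matrix (Fin 2) (Fin 2) ℝ) *ᵥ grad (V j) z) - ev (V j) z * ev (V j) z)
        by
      have hi : ∀ j, ∫ z in (𝒯.tri j).opn, (4 * R ^ 2 *
          (grad (V j) z ⬝ᵥ (1 : Matrix (Fin 2) (Fin 2) ℝ) *ᵥ grad (V j) z) -
            ev (V j) z * ev (V j) z) =
          4 * R ^ 2 * (∫ z in (𝒯.tri j).opn,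
            grad (V j) z ⬝ᵥ (1 : Matrix (Fin 2) (Fin 2) ℝ) *ᵥ grad (V j) z) -
            ∫ z in (𝒯.tri j).opn, ev (V j) z * ev (V j) z := by
        intro j
        have c1 := continuous_ev (V j)
        have c2 := continuous_ev (dx (V j))
        have c3 := continuous_ev (dy (V j))
        simp only [dotProduct_one_grad]
        rw [integral_sub, integral_const_mul]
        · exact (𝒯.tri j).integrableOn_opn (by fun_prop)
        · exact (𝒯.tri j).integrableOn_opn (by fun_prop)
      rw [Finset.sum_congr rfl fun j _ => hi j, Finset.sum_sub_distrib, ← Finset.mul_sum] at this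
      linarith
    refine h1.trans (Finset.sum_le_sum fun j _ => ?_)
    have c1 := continuous_ev (V j)
    have c2 := continuous_ev (dx (V j))
    have c3 := continuous_ev (dy (V j))
    refine setIntegral_mono_on ((𝒯.tri j).integrableOn_opn (continuous_ev _))
      ((𝒯.tri j).integrableOn_opn (by simp only [dotProduct_one_grad]; fun_prop))
      (𝒯.tri j).isOpen_opn.measurableSet fun z hz => ?_
    rw [dx_C_mul_X_mul_sq, dotProduct_one_grad]
    have hzR : |z 0| ≤ R := (PiLp.norm_apply_le z 0).trans
      (hR z (closed_subset_closure j ((𝒯.tri j).opn_subset_closed hz)))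
    have hz2 : z 0 ^ 2 ≤ R ^ 2 := sq_le_sq.2 (by rwa [abs_of_pos hR0])
    nlinarith [sq_nonneg (ev (V j) z + 2 * (z 0 * ev (dx (V j)) z)),
      mul_le_mul_of_nonneg_right hz2 (sq_nonneg (ev (dx (V j)) z)),
      mul_nonneg (sq_nonneg R) (sq_nonneg (ev (dy (V j)) z))]
  · exact ⟨1, one_pos, fun 𝒯 => absurd ⟨𝒯⟩ hne⟩

end Triangulation

/-! ### Numerical fluxes on the diagonal -/

/-- The quadratic form of the matrix `A`. -/
def quad (α β γ x y : ℝ) : ℝ := α * x ^ 2 + 2 * β * x * y + γ * y ^ 2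

theorem quad_nonneg {α β γ : ℝ} (hA : (matA α β γ).PosSemidef) (x y : ℝ) :
    0 ≤ quad α β γ x y := by
  have := hA.dotProduct_mulVec_nonneg ![x, y]
  simp [matA, dotProduct, Matrix.mulVec, Fin.sum_univ_two] at this
  unfold quad; linarith

/-- The quadratic form of `A` at the gradient of a polynomial. -/
def gradQuad (α β γ : ℝ) (q : Poly) (z : Plane) : ℝ := quad α β γ (ev (dx q) z) (ev (dy q) z)

theorem continuous_gradQuad (α β γ : ℝ) (q : Poly) : Continuous (gradQuad α β γ q) := by
  have c1 := continuous_ev (dx q)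
  have c2 := continuous_ev (dy q)
  unfold gradQuad quad
  fun_prop

theorem grad_dotProduct_matA (α β γ : ℝ) (q : Poly) (z : Plane) :
    grad q z ⬝ᵥ matA α β γ *ᵥ grad q z = gradQuad α β γ q z := by
  simp [grad, matA, dotProduct, Matrix.mulVec, Fin.sum_univ_two, gradQuad, quad]; ring

namespace Triangulation

section Flux

variable {α β γ κ lam τ : ℝ} {n z : Plane} {w v : Poly}

/-- For `V = U` and symmetric `A`, averages times jumps combine to half the jump of the quadratic
form. The advective flux is therefore exactly what cancels the transport terms from the two sides.
-/
theorem fluxInterior_self (α β γ κ lam τ : ℝ) (n : Plane) (w v : Poly) (z : Plane) :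
    fluxInterior (matA α β γ) κ lam τ n w v w v z =
      |z 0 * n 1| / 2 * (κ * ((n 0 ^ 2 + n 1 ^ 2) * (ev (dx w) z - ev (dx v) z) ^ 2) +
          lam * ((n 0 ^ 2 + n 1 ^ 2) * (ev (dy w) z - ev (dy v) z) ^ 2))
        - z 0 * n 1 / 2 * (gradQuad α β γ w z - gradQuad α β γ v z)
        - (n 0 * (α * (ev (dx (dx w)) z + ev (dx (dx v)) z) * (ev (dx w) z - ev (dx v) z)
            + β * (ev (dx (dx w)) z + ev (dx (dx v)) z) * (ev (dy w) z - ev (dy v) z)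
            + β * (ev (dy (dx w)) z + ev (dy (dx v)) z) * (ev (dx w) z - ev (dx v) z)
            + γ * (ev (dy (dx w)) z + ev (dy (dx v)) z) * (ev (dy w) z - ev (dy v) z))
          - τ * n 0 ^ 2 * quad α β γ (ev (dx w) z - ev (dx v) z) (ev (dy w) z - ev (dy v) z)) := by
  simp [fluxInterior, jump, jumpOne, avg, avgVec, grad, matA, dotProduct, Matrix.mulVec,
    Fin.sum_univ_two, gradQuad, quad]
  ring

theorem fluxElliptic_self (α β γ τ : ℝ) (n : Plane) (w : Poly) (z : Plane) :
    fluxElliptic (matA α β γ) τ n w w z =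
      -(2 * n 0 * (α * ev (dx (dx w)) z * ev (dx w) z + β * ev (dx (dx w)) z * ev (dy w) z
          + β * ev (dy (dx w)) z * ev (dx w) z + γ * ev (dy (dx w)) z * ev (dy w) z)
        - τ * n 0 ^ 2 * gradQuad α β γ w z) := by
  simp [fluxElliptic, jumpOne, grad, matA, dotProduct, Matrix.mulVec, Fin.sum_univ_two, gradQuad,
    quad]
  ring

theorem fluxInflow_self (α β γ : ℝ) (n : Plane) (w : Poly) (z : Plane) :
    fluxInflow (matA α β γ) n w w z = -(z 0 * n 1 * gradQuad α β γ w z) := by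
  simp [fluxInflow, jump, matA, dotProduct, Fin.sum_univ_two, gradQuad, quad]
  ring

theorem continuous_fluxInterior_self (α β γ κ lam τ : ℝ) (n : Plane) (w v : Poly) :
    Continuous (fluxInterior (matA α β γ) κ lam τ n w v w v) := by
  have h := fluxInterior_self α β γ κ lam τ n w v
  rw [funext h]
  have c1 := continuous_ev (dx w)
  have c2 := continuous_ev (dy w)
  have c3 := continuous_ev (dx v)
  have c4 := continuous_ev (dy v)
  have c5 := continuous_ev (dx (dx w))
  have c6 := continuous_ev (dy (dx w))
  have c7 := continuous_ev (dx (dx v))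
  have c8 := continuous_ev (dy (dx v))
  have c9 := continuous_gradQuad α β γ w
  have c10 := continuous_gradQuad α β γ v
  unfold quad
  fun_prop

theorem continuous_fluxElliptic_self (α β γ τ : ℝ) (n : Plane) (w : Poly) :
    Continuous (fluxElliptic (matA α β γ) τ n w w) := by
  rw [funext (fluxElliptic_self α β γ τ n w)]
  have c1 := continuous_ev (dx w)
  have c2 := continuous_ev (dy w)
  have c5 := continuous_ev (dx (dx w))
  have c6 := continuous_ev (dy (dx w))
  have c9 := continuous_gradQuad α β γ w
  fun_prop

theorem continuous_fluxInflow_self (α β γ : ℝ) (n : Plane) (w : Poly) :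
    Continuous (fluxInflow (matA α β γ) n w w) := by
  rw [funext (fluxInflow_self α β γ n w)]
  have c9 := continuous_gradQuad α β γ w
  fun_prop

/-- On an interface the penalty controls the consistency terms. -/
theorem fluxInterior_nonneg (hA : (matA α β γ).PosSemidef) (hκ : 0 ≤ κ) (hlam : 0 ≤ lam)
    (hτ : 0 < τ) {θ θ' : ℝ} (hθ : 1 / (2 * τ) ≤ θ) (hθ' : 1 / (2 * τ) ≤ θ') :
    0 ≤ z 0 * n 1 / 2 * (gradQuad α β γ w z - gradQuad α β γ v z)
      + θ * gradQuad α β γ (dx w) z + θ' * gradQuad α β γ (dx v) z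
      + fluxInterior (matA α β γ) κ lam τ n w v w v z := by
  rw [fluxInterior_self]
  have hup : 0 ≤ |z 0 * n 1| / 2 * (κ * ((n 0 ^ 2 + n 1 ^ 2) * (ev (dx w) z - ev (dx v) z) ^ 2) +
          lam * ((n 0 ^ 2 + n 1 ^ 2) * (ev (dy w) z - ev (dy v) z) ^ 2)) := by positivity
  have ha : 0 ≤ gradQuad α β γ (dx w) z := quad_nonneg hA _ _
  have hb : 0 ≤ gradQuad α β γ (dx v) z := quad_nonneg hA _ _
  have h1 := mul_le_mul_of_nonneg_right hθ ha
  have h2 := mul_le_mul_of_nonneg_right hθ' hb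
  unfold gradQuad at ha hb h1 h2 ⊢
  set xw := ev (dx (dx w)) z
  set xv := ev (dx (dx v)) z
  set yw := ev (dy (dx w)) z
  set yv := ev (dy (dx v)) z
  set jx := ev (dx w) z - ev (dx v) z
  set jy := ev (dy w) z - ev (dy v) z
  -- Completing the square with the penalty leaves the form at the average of the two traces. Adding
  -- the form at half their difference turns it, by the parallelogram law, into half the sum of the
  -- two one-sided values, hence the threshold `1 / (2τ)`.
  have h3 := quad_nonneg hA (τ * n 0 * jx - (xw + xv) / 2) (τ * n 0 * jy - (yw + yv) / 2)
  have h4 := quad_nonneg hA ((xw - xv) / 2) ((yw - yv) / 2)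
  have h5 : 0 ≤ 1 / τ * (quad α β γ (τ * n 0 * jx - (xw + xv) / 2) (τ * n 0 * jy - (yw + yv) / 2)
    + quad α β γ ((xw - xv) / 2) ((yw - yv) / 2)) := by positivity
  have h6 : 1 / τ * (quad α β γ (τ * n 0 * jx - (xw + xv) / 2) (τ * n 0 * jy - (yw + yv) / 2)
    + quad α β γ ((xw - xv) / 2) ((yw - yv) / 2)) =
      1 / (2 * τ) * quad α β γ xw yw + 1 / (2 * τ) * quad α β γ xv yv
      - (n 0 * (α * (xw + xv) * jx + β * (xw + xv) * jy + β * (yw + yv) * jx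
            + γ * (yw + yv) * jy) - τ * n 0 ^ 2 * quad α β γ jx jy) := by
    unfold quad; field_simp; ring
  linarith

/-- On `∂₀Ω` the penalty controls the consistency terms and the transport. -/
theorem fluxElliptic_nonneg (hA : (matA α β γ).PosSemidef)
    (hτ : 0 < τ) {θ : ℝ} (hθ : 2 / τ ≤ θ) (hn : |z 0 * n 1| ≤ τ * n 0 ^ 2) :
    0 ≤ z 0 * n 1 / 2 * gradQuad α β γ w z + θ * gradQuad α β γ (dx w) z
      + fluxElliptic (matA α β γ) τ n w w z := by
  rw [fluxElliptic_self]
  have ha : 0 ≤ gradQuad α β γ (dx w) z := quad_nonneg hA _ _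
  have hg : 0 ≤ gradQuad α β γ w z := quad_nonneg hA _ _
  have h1 := mul_le_mul_of_nonneg_right hθ ha
  have h2 := mul_le_mul_of_nonneg_right (neg_le_of_abs_le hn) hg
  unfold gradQuad at *
  set xw := ev (dx (dx w)) z
  set yw := ev (dy (dx w)) z
  set gx := ev (dx w) z
  set gy := ev (dy w) z
  -- Only half of the penalty enters the square; the other half is reserved for the transport term
  -- through `hn`. This costs the larger threshold `2 / τ`.
  have h3 := quad_nonneg hA (τ / 2 * n 0 * gx - xw) (τ / 2 * n 0 * gy - yw)
  have h5 : 0 ≤ 2 / τ * quad α β γ (τ / 2 * n 0 * gx - xw) (τ / 2 * n 0 * gy - yw) := by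
    positivity
  have h6 : 2 / τ * quad α β γ (τ / 2 * n 0 * gx - xw) (τ / 2 * n 0 * gy - yw) =
      τ * n 0 ^ 2 * quad α β γ gx gy / 2 + 2 / τ * quad α β γ xw yw
      - 2 * n 0 * (α * xw * gx + β * xw * gy + β * yw * gx + γ * yw * gy) := by
    unfold quad; field_simp; ring
  linarith

end Flux

/-! ### Volume density and positivity of the surface terms -/

/-- The polynomial whose `y`-derivative collects the transport terms. -/
def transport (α β γ : ℝ) (q : Poly) : Poly :=
  MvPolynomial.X 0 * (MvPolynomial.C (1 / 2) * (q * q + (MvPolynomial.C α * (dx q * dx q) +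
    MvPolynomial.C (2 * β) * (dx q * dy q) + MvPolynomial.C γ * (dy q * dy q))))

theorem ev_transport (α β γ : ℝ) (q : Poly) (z : Plane) :
    ev (transport α β γ q) z = z 0 / 2 * (ev q z ^ 2 + gradQuad α β γ q z) := by
  simp [transport, gradQuad, quad]; ring

theorem dy_C (c : ℝ) : dy (MvPolynomial.C c) = 0 := by simp [dy]

theorem dy_add (q r : Poly) : dy (q + r) = dy q + dy r := by simp [dy]

/-- The hypocoercive identity: `∇(x U_y) = (U_y, 0) + x ∇U_y`. Paired with `A∇U`, the first vector
gives `α U_x U_y + β U_y²`; the second, together with `x U_y U`, is an exact `y`-derivative since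
`A` is symmetric. -/
theorem volume_density_eq (α β γ : ℝ) (q : Poly) (z : Plane) :
    ev (dx q) z * ev (dx q) z + z 0 * ev (dy q) z * ev q z
      + (matA α β γ *ᵥ grad (dx q) z) ⬝ᵥ grad (dx q) z
      + grad (MvPolynomial.X 0 * dy q) z ⬝ᵥ matA α β γ *ᵥ grad q z =
    (ev (dx q) z ^ 2 + α * ev (dx q) z * ev (dy q) z + β * ev (dy q) z ^ 2)
      + gradQuad α β γ (dx q) z + ev (dy (transport α β γ q)) z := by
  have h1 : dx (MvPolynomial.X 0 * dy q) = dy q + MvPolynomial.X 0 * dy (dx q) := by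
    rw [dx_mul, dx_dy_comm]; simp [dx]
  have h2 : dy (MvPolynomial.X 0 * dy q) = MvPolynomial.X 0 * dy (dy q) := by
    rw [dy_mul]; simp [dy]
  have h3 : dy (MvPolynomial.X 0 : Poly) = 0 := by simp [dy]
  simp only [grad, h1, h2, transport, dy_mul, dy_add, dy_C, h3]
  simp [matA, dotProduct, Matrix.mulVec, Fin.sum_univ_two, gradQuad, quad, ev]
  ring

variable {Ω : Set Plane} {𝒯 : Triangulation Ω}

/-- All fluxes are written as densities on triangle edges, so that they can be added to the boundary
terms of the divergence theorem. The flux of an interface is booked entirely on the side with the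
smaller index. -/
theorem sForm_eq (𝒯 : Triangulation Ω) (hΩ : interior (closure Ω) = Ω) (p : ℕ) (α β γ κ lam Cτ : ℝ)
    (W : 𝒯.PW) : 𝒯.sForm p (matA α β γ) κ lam Cτ W W =
      ∑ j, ∑ i, ((∫ z in (𝒯.tri j).edge i, ∑ k, (if j < k then
        ((𝒯.tri k).closed ∩ Ω).indicator
          (fluxInterior (matA α β γ) κ lam (Cτ * (p : ℝ) ^ 2 / avg (𝒯.tri j).h (𝒯.tri k).h)
          ((𝒯.tri j).normal i) (W j) (W k) (W j) (W k)) z else 0) ∂arc)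
        + (∫ z in (𝒯.tri j).edge i, (inflowBoundary Ω).indicator
          (fluxInflow (matA α β γ) ((𝒯.tri j).normal i) (W j) (W j)) z ∂arc)
        + (∫ z in (𝒯.tri j).edge i, (ellipticBoundary Ω).indicator
          (fluxElliptic (matA α β γ) (Cτ * (p : ℝ) ^ 2 / (𝒯.tri j).h) ((𝒯.tri j).normal i)
            (W j) (W j)) z ∂arc)) := by
  simp only [sForm, Triangle.edgeIntegral_eq, Finset.sum_add_distrib]
  congr 2
  refine Finset.sum_congr rfl fun j _ => ?_
  have h : ∀ i, (∫ z in (𝒯.tri j).edge i, ∑ k, (if j < k then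
        ((𝒯.tri k).closed ∩ Ω).indicator
          (fluxInterior (matA α β γ) κ lam (Cτ * (p : ℝ) ^ 2 / avg (𝒯.tri j).h (𝒯.tri k).h)
          ((𝒯.tri j).normal i) (W j) (W k) (W j) (W k)) z else 0) ∂arc) =
      ∑ k, if j < k then ∫ z in (𝒯.tri j).edge i, ((𝒯.tri k).closed ∩ Ω).indicator
          (fluxInterior (matA α β γ) κ lam (Cτ * (p : ℝ) ^ 2 / avg (𝒯.tri j).h (𝒯.tri k).h)
          ((𝒯.tri j).normal i) (W j) (W k) (W j) (W k)) z ∂arc else 0 := by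
    intro i
    rw [integral_finsetSum]
    · refine Finset.sum_congr rfl fun k _ => ?_
      split_ifs <;> simp
    · intro k _
      split_ifs
      · exact integrableOn_indicator_closed_inter hΩ j k i
          (continuous_fluxInterior_self _ _ _ _ _ _ _ _ _)
      · exact integrable_zero _ _ _
  simp only [h]
  rw [Finset.sum_comm]
  refine Finset.sum_congr rfl fun k _ => ?_
  split_ifs <;> simp

theorem sum_integral_eq_integral_sum {X : Type*} [MeasurableSpace X] {μ : Measure X}
    {f₁ f₂ f₃ f₄ f₅ : X → ℝ} (h₁ : Integrable f₁ μ) (h₂ : Integrable f₂ μ) (h₃ : Integrable f₃ μ)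
    (h₄ : Integrable f₄ μ) (h₅ : Integrable f₅ μ) :
    ∫ x, f₁ x ∂μ + (∫ x, f₂ x ∂μ + ∫ x, f₃ x ∂μ + ∫ x, f₄ x ∂μ) + ∫ x, f₅ x ∂μ =
      ∫ x, (f₁ x + (f₂ x + f₃ x + f₄ x) + f₅ x) ∂μ := by
  change _ = ∫ x, (f₁ + (f₂ + f₃ + f₄) + f₅) x ∂μ
  rw [integral_add' (h₁.add ((h₂.add h₃).add h₄)) h₅, integral_add' h₁ ((h₂.add h₃).add h₄),
    integral_add' (h₂.add h₃) h₄, integral_add' h₂ h₃]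

/-- The surface terms are nonnegative up to traces of `A ∇U_x · ∇U_x`. -/
theorem surface_nonneg (hΩ : interior (closure Ω) = Ω) {p : ℕ} {U : 𝒯.PW} (hU : U ∈ 𝒯.feSpace p)
    {α β γ κ lam Cτ c R : ℝ} (hA : (matA α β γ).PosSemidef) (hκ : 0 ≤ κ) (hlam : 0 ≤ lam)
    (hp : 0 < p) (hCτ : 0 < Cτ) (θ : Fin 𝒯.n → ℝ) {N : Set Plane} (hN : N.Finite)
    (hI : ∀ j k, ((𝒯.tri j).closed ∩ (𝒯.tri k).closed).Nontrivial →
      avg (𝒯.tri j).h (𝒯.tri k).h / (2 * Cτ * p ^ 2) ≤ θ j)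
    (hB : ∀ j, 2 * (𝒯.tri j).h / (Cτ * p ^ 2) ≤ θ j)
    (hR : ∀ z ∈ closure Ω, |z 0| ≤ R)
    (hc : ∀ z n, z ∉ N → IsOutwardNormal Ω z n → n 0 ≠ 0 → c ≤ n 0 ^ 2)
    (hh : ∀ j, R ≤ Cτ * p ^ 2 / (𝒯.tri j).h * c) :
    0 ≤ (∑ j, ∫ z in (𝒯.tri j).opn, ev (dy (transport α β γ (U j))) z)
      + 𝒯.sForm p (matA α β γ) κ lam Cτ U U
      + ∑ j, ∑ i, ∫ z in (𝒯.tri j).edge i, θ j * gradQuad α β γ (dx (U j)) z ∂arc := by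
  obtain ⟨-, hU2, hU3⟩ := hU
  have hp' : (0 : ℝ) < p := by exact_mod_cast hp
  rw [sForm_eq 𝒯 hΩ]
  simp only [Triangle.integral_dy]
  have i1 : ∀ j i, IntegrableOn (fun z => (𝒯.tri j).normal i 1 * ev (transport α β γ (U j)) z)
      ((𝒯.tri j).edge i) arc := fun j i => by
    have := continuous_ev (transport α β γ (U j))
    exact (𝒯.tri j).integrableOn_edge i (by fun_prop)
  have i2 : ∀ j i, IntegrableOn (fun z => ∑ k, (if j < k then
        ((𝒯.tri k).closed ∩ Ω).indicator
          (fluxInterior (matA α β γ) κ lam (Cτ * (p : ℝ) ^ 2 / avg (𝒯.tri j).h (𝒯.tri k).h)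
          ((𝒯.tri j).normal i) (U j) (U k) (U j) (U k)) z else 0)) ((𝒯.tri j).edge i) arc :=
    fun j i => integrable_finsetSum _ fun k _ => by
      split_ifs
      · exact integrableOn_indicator_closed_inter hΩ j k i
          (continuous_fluxInterior_self _ _ _ _ _ _ _ _ _)
      · exact integrable_zero _ _ _
  have i3 : ∀ j i, IntegrableOn (fun z => (inflowBoundary Ω).indicator
      (fluxInflow (matA α β γ) ((𝒯.tri j).normal i) (U j) (U j)) z) ((𝒯.tri j).edge i) arc :=
    fun j i => integrableOn_indicator_inflowBoundary hΩ j i (continuous_fluxInflow_self _ _ _ _ _)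
  have i4 : ∀ j i, IntegrableOn (fun z => (ellipticBoundary Ω).indicator
      (fluxElliptic (matA α β γ) (Cτ * (p : ℝ) ^ 2 / (𝒯.tri j).h) ((𝒯.tri j).normal i)
            (U j) (U j)) z) ((𝒯.tri j).edge i) arc :=
    fun j i => integrableOn_indicator_ellipticBoundary hΩ j i
      (continuous_fluxElliptic_self _ _ _ _ _ _)
  have i5 : ∀ j i, IntegrableOn (fun z => θ j * gradQuad α β γ (dx (U j)) z)
      ((𝒯.tri j).edge i) arc := fun j i => by
    have := continuous_gradQuad α β γ (dx (U j))
    exact (𝒯.tri j).integrableOn_edge i (by fun_prop)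
  rw [← Finset.sum_add_distrib, ← Finset.sum_add_distrib]
  simp only [← Finset.sum_add_distrib]
  rw [Finset.sum_congr rfl fun j _ => Finset.sum_congr rfl fun i _ =>
    sum_integral_eq_integral_sum (i1 j i) (i2 j i) (i3 j i) (i4 j i) (i5 j i)]
  have hτI : ∀ j k, 0 < Cτ * (p : ℝ) ^ 2 / avg (𝒯.tri j).h (𝒯.tri k).h := fun j k => by
    have h1 := (𝒯.tri j).h_pos
    have h2 := (𝒯.tri k).h_pos
    unfold avg; positivity
  have hτB : ∀ j, 0 < Cτ * (p : ℝ) ^ 2 / (𝒯.tri j).h := fun j => by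
    have h1 := (𝒯.tri j).h_pos
    positivity
  refine sum_integral_edge_nonneg hΩ _ (fun j i =>
    ((i1 j i).add (((i2 j i).add (i3 j i)).add (i4 j i))).add (i5 j i)) hN ?_ ?_
  · intro z j i k i' _ h hjk
    have hin : z ∉ inflowBoundary Ω := fun h' => notMem_of_mem_inflowBoundary h' h.mem
    have hel : z ∉ ellipticBoundary Ω := fun h' => notMem_of_mem_ellipticBoundary h' h.mem
    have hkc := (𝒯.tri k).edge_subset_closed i' h.mem_right
    have hjc := (𝒯.tri j).edge_subset_closed i h.mem_left
    rw [Set.indicator_of_notMem hin, Set.indicator_of_notMem hel, Set.indicator_of_notMem hin,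
      Set.indicator_of_notMem hel, Finset.sum_eq_single k, if_pos hjk,
      Set.indicator_of_mem (show z ∈ (𝒯.tri k).closed ∩ Ω from ⟨hkc, h.mem⟩),
      Finset.sum_eq_zero]
    · have e := hU2 j k z ⟨hjc, hkc⟩
      have hf := fluxInterior_nonneg (z := z) (n := (𝒯.tri j).normal i) (w := U j) (v := U k)
        hA hκ hlam (hτI j k) (θ := θ j) (θ' := θ k)
        (by
          refine le_trans (le_of_eq ?_) (hI j k h.nontrivial)
          field_simp)
        (by
          refine le_trans (le_of_eq ?_) (hI k j (by rw [Set.inter_comm]; exact h.nontrivial))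
          rw [show avg (𝒯.tri k).h (𝒯.tri j).h = avg (𝒯.tri j).h (𝒯.tri k).h by
            unfold avg; ring]
          field_simp)
      rw [h.normal_eq, ev_transport, ev_transport, e]
      simp only [PiLp.neg_apply]
      linarith
    -- The side with the larger index carries no flux: only `j` and `k` meet at `z`, and neither
    -- exceeds `k`.
    · intro l _
      split_ifs with hkl
      · refine Set.indicator_of_notMem (fun h' => ?_) _
        rcases h.eq_or_eq l h'.1 with rfl | rfl
        · exact absurd hkl (not_lt.2 hjk.le)
        · exact lt_irrefl _ hkl
      · rfl
    · intro l _ hlk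
      split_ifs with hjl
      · refine Set.indicator_of_notMem (fun h' => ?_) _
        rcases h.eq_or_eq l h'.1 with rfl | rfl
        · exact lt_irrefl _ hjl
        · exact hlk rfl
      · rfl
    · simp
  · intro z j i hzN h
    have hjc := (𝒯.tri j).edge_subset_closed i h.mem_edge
    have hg : 0 ≤ gradQuad α β γ (U j) z := quad_nonneg hA _ _
    have ha : 0 ≤ gradQuad α β γ (dx (U j)) z := quad_nonneg hA _ _
    have hθ : 0 ≤ θ j := by
      refine le_trans ?_ (hB j)
      have h1 := (𝒯.tri j).h_pos
      positivity
    rw [Finset.sum_eq_zero, ev_transport]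
    · by_cases h0 : (𝒯.tri j).normal i 0 = 0
      · have hel : z ∉ ellipticBoundary Ω := fun h' =>
          (mem_ellipticBoundary_iff h.normal).1 h' h0
        rw [Set.indicator_of_notMem hel]
        have hθa := mul_nonneg hθ ha
        by_cases hlt : z 0 * (𝒯.tri j).normal i 1 < 0
        -- The flux subtracts `x n₂ A∇U · ∇U` in full, twice what the transport contributes, so what
        -- remains is positive for `x n₂ < 0`. The term with `U²` vanishes by the boundary
        -- condition.
        · have hin := (mem_inflowBoundary_iff h.normal).2 ⟨h0, hlt⟩
          rw [Set.indicator_of_mem hin, fluxInflow_self, hU3 j z ⟨hjc, Or.inl hin⟩]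
          nlinarith [mul_nonneg (neg_nonneg.2 hlt.le) hg]
        · have hin : z ∉ inflowBoundary Ω := fun h' =>
            hlt ((mem_inflowBoundary_iff h.normal).1 h').2
          rw [Set.indicator_of_notMem hin]
          -- No boundary condition holds here, but `x n₂ ≥ 0` gives the whole transport term the
          -- right sign.
          nlinarith [mul_nonneg (not_lt.1 hlt) (add_nonneg (sq_nonneg (ev (U j) z)) hg)]
      · have hel := (mem_ellipticBoundary_iff h.normal).2 h0
        have hin : z ∉ inflowBoundary Ω := fun h' =>
          h0 ((mem_inflowBoundary_iff h.normal).1 h').1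
        rw [Set.indicator_of_mem hel, Set.indicator_of_notMem hin, hU3 j z ⟨hjc, Or.inr hel⟩]
        have hn1 : |(𝒯.tri j).normal i 1| ≤ 1 :=
          (PiLp.norm_apply_le ((𝒯.tri j).normal i) 1).trans_eq ((𝒯.tri j).norm_normal i)
        have hf := fluxElliptic_nonneg (z := z) (n := (𝒯.tri j).normal i) (w := U j)
          hA (hτB j) (θ := θ j)
          (by
            refine le_trans (le_of_eq ?_) (hB j)
            field_simp)
          (by
            rw [abs_mul]
            calc _ ≤ |z 0| * 1 := mul_le_mul_of_nonneg_left hn1 (abs_nonneg _)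
              _ ≤ R := by rw [mul_one]; exact hR z (closed_subset_closure j hjc)
              _ ≤ _ := hh j
              _ ≤ _ := mul_le_mul_of_nonneg_left (hc z _ hzN h.normal h0) (hτB j).le)
        linarith
    · intro l _
      split_ifs with hjl
      · refine Set.indicator_of_notMem (fun h' => ?_) _
        exact hjl.ne (h.eq l h'.1).symm
      · rfl

end Triangulation

/-! ### The coefficient matrices -/

section Coefficients

/-- Young's inequality for the mixed term `α x y`, with the defect an exact square; the matrix `B`
is chosen to be what Young's inequality leaves, doubled. -/
theorem one_half_quad_le {α ε : ℝ} (β : ℝ) (hε : 0 < ε) (x y : ℝ) :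
    (2 * (1 - ε) * x ^ 2 + (2 * β - α ^ 2 / (2 * ε)) * y ^ 2) / 2 ≤
      x ^ 2 + α * x * y + β * y ^ 2 := by
  have h : x ^ 2 + α * x * y + β * y ^ 2 -
      (2 * (1 - ε) * x ^ 2 + (2 * β - α ^ 2 / (2 * ε)) * y ^ 2) / 2 =
      ε * (x + α / (2 * ε) * y) ^ 2 := by field_simp; ring
  have : 0 ≤ ε * (x + α / (2 * ε) * y) ^ 2 := by positivity
  linarith

theorem isHermitian_matB_sub_matA (α β γ ε : ℝ) : (matB α β ε - matA α β γ).IsHermitian := by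
  ext i j
  fin_cases i <;> fin_cases j <;> simp [matA, matB]

/-- The matrix `B` dominates `A + μ`. -/
theorem Admissible.quad_le {α β γ ε μ : ℝ} (h : Admissible α β γ ε μ) (x y : ℝ) :
    quad α β γ x y + μ * (x ^ 2 + y ^ 2) ≤
      2 * (1 - ε) * x ^ 2 + (2 * β - α ^ 2 / (2 * ε)) * y ^ 2 := by
  set M := matB α β ε - matA α β γ with hM
  -- Since `μ` bounds the spectrum of `M` from below, the shifted matrix has non-negative spectrum.
  have hpos : (M - algebraMap ℝ _ μ).PosSemidef := by
    rw [Matrix.posSemidef_iff_isHermitian_and_spectrum_nonneg, ← spectrum.sub_singleton_eq]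
    constructor
    · refine (isHermitian_matB_sub_matA α β γ ε).sub ?_
      rw [Matrix.algebraMap_eq_diagonal]
      ext i j
      fin_cases i <;> fin_cases j <;> simp
    · rintro _ ⟨a, ha, b, rfl, rfl⟩
      exact sub_nonneg.2 (h.isLeast.2 ha)
  have := hpos.dotProduct_mulVec_nonneg ![x, y]
  simp [hM, matA, matB, dotProduct, Matrix.mulVec, Fin.sum_univ_two, Matrix.algebraMap_eq_diagonal]
    at this
  unfold quad
  linarith

/-- With `β = α / 2`, `γ = α / 4` and `ε = 1 / 2`, the form of `A` is the degenerate square `α (x +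
y / 2)²`, and `B - A` has determinant `α (1/2 - α)(3/2 - α)`, which is where `α < 1/2` enters. -/
theorem exists_admissible {α : ℝ} (h0 : 0 < α) (h1 : α < 1 / 2) :
    ∃ β γ ε μ : ℝ, Admissible α β γ ε μ := by
  set M := matB α (α / 2) (1 / 2) - matA α (α / 2) (α / 4) with hM
  have hH : M.IsHermitian := isHermitian_matB_sub_matA _ _ _ _
  have hspec := hH.spectrum_real_eq_range_eigenvalues
  obtain ⟨i, hi⟩ := Finite.exists_min hH.eigenvalues
  have hpd : M.PosDef := by
    refine Matrix.PosDef.of_dotProduct_mulVec_pos hH fun v hv => ?_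
    simp [hM, matA, matB, dotProduct, Matrix.mulVec, Fin.sum_univ_two]
    have e : v 0 * ((2 * (1 - 2⁻¹) - α) * v 0 + -(α / 2 * v 1)) +
        v 1 * (-(α / 2 * v 0) + (2 * (α / 2) - α ^ 2 - α / 4) * v 1) =
        (1 - α) * (v 0 - α / (2 * (1 - α)) * v 1) ^ 2 +
          α * ((1 / 2 - α) * (3 / 2 - α)) / (1 - α) * v 1 ^ 2 := by
      have : 1 - α ≠ 0 := by linarith
      field_simp; ring
    have h3 : 0 < 1 - α := by linarith
    have h4 : 0 < α * ((1 / 2 - α) * (3 / 2 - α)) / (1 - α) :=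
      div_pos (mul_pos h0 (mul_pos (by linarith) (by linarith))) h3
    have goal : 0 < (1 - α) * (v 0 - α / (2 * (1 - α)) * v 1) ^ 2 +
          α * ((1 / 2 - α) * (3 / 2 - α)) / (1 - α) * v 1 ^ 2 := by
      by_cases hv1 : v 1 = 0
      · have hv0 : v 0 ≠ 0 := fun hv0 => hv (by ext k; fin_cases k <;> simp [hv0, hv1])
        rw [hv1]; simp only [mul_zero, sub_zero]
        positivity
      · positivity
    rw [← e] at goal
    linarith
  refine ⟨α / 2, α / 4, 1 / 2, hH.eigenvalues i, h0, h1, by linarith, by linarith, by linarith,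
    by norm_num, by norm_num, ?_, ?_, hH.posDef_iff_eigenvalues_pos.1 hpd i⟩
  · refine Matrix.PosSemidef.of_dotProduct_mulVec_nonneg ?_ fun v => ?_
    · ext i j
      fin_cases i <;> fin_cases j <;> simp [matA]
    · simp [matA, dotProduct, Matrix.mulVec, Fin.sum_univ_two]
      nlinarith [mul_nonneg h0.le (sq_nonneg (v 0 + v 1 / 2))]
  · rw [hspec]
    exact ⟨⟨i, rfl⟩, by rintro _ ⟨k, rfl⟩; exact hi k⟩

end Coefficients

/-! ### Coercivity of the discrete form -/

theorem totalDegree_pderiv_le (i : Fin 2) (q : Poly) :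
    (MvPolynomial.pderiv i q).totalDegree ≤ q.totalDegree := by
  conv_lhs => rw [q.as_sum]
  rw [map_sum]
  refine MvPolynomial.totalDegree_finsetSum_le fun m hm => ?_
  rw [MvPolynomial.pderiv_monomial]
  refine (MvPolynomial.totalDegree_monomial_le _ _).trans ?_
  refine le_trans ?_ (MvPolynomial.le_totalDegree hm)
  rw [Finsupp.sum_fintype _ _ (fun _ => rfl), Finsupp.sum_fintype _ _ (fun _ => rfl)]
  exact Finset.sum_le_sum fun k _ => by simp

/-- The inverse trace estimate for the form `A ∇q · ∇q`. -/
theorem Triangle.sum_edge_gradQuad_le (T : Triangle) {σ r : ℝ} {c : Plane} (hr : 0 < r)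
    (hc : Metric.closedBall c r ⊆ T.closed) (hσ : T.h ≤ σ * r) {p : ℕ} (hp : 1 ≤ p) {q : Poly}
    (hq : q.totalDegree ≤ p) {α β γ : ℝ} (hα : 0 < α) (hA : (matA α β γ).PosSemidef) :
    ∑ i, ∫ z in T.edge i, T.h / (24 * σ * p ^ 2) * gradQuad α β γ q z ∂arc ≤
      ∫ z in T.opn, gradQuad α β γ q z := by
  -- Diagonalising the constant form by completing the square makes `A∇q · ∇q` a non-negative
  -- combination of squares of two polynomials, so the scalar trace estimate applies to each with a
  -- constant independent of `A`.
  set q1 : Poly := dx q + (β / α) • dy q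
  have hx : (dx q).totalDegree ≤ p := (totalDegree_pderiv_le 0 q).trans hq
  have hy : (dy q).totalDegree ≤ p := (totalDegree_pderiv_le 1 q).trans hq
  have hq1 : q1.totalDegree ≤ p := (MvPolynomial.totalDegree_add _ _).trans
    (max_le hx ((MvPolynomial.totalDegree_smul_le _ _).trans hy))
  set δ := γ - β ^ 2 / α
  have hδ : 0 ≤ δ := by
    have h := quad_nonneg hA (-(β / α)) 1
    have e : quad α β γ (-(β / α)) 1 = δ := by unfold quad; simp only [δ]; field_simp; ring
    rwa [e] at h
  have e : gradQuad α β γ q = fun z => α * ev q1 z ^ 2 + δ * ev (dy q) z ^ 2 := by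
    funext z
    have : ev q1 z = ev (dx q) z + β / α * ev (dy q) z := by simp [q1, ev]
    rw [this]
    unfold gradQuad quad
    simp only [δ]
    field_simp
    ring
  have h1 := T.h_mul_sum_edge_sq_le hr hc hσ hp hq1
  have h2 := T.h_mul_sum_edge_sq_le hr hc hσ hp hy
  have c1 := continuous_ev q1
  have c2 := continuous_ev (dy q)
  have hsplit : ∀ i, ∫ z in T.edge i, T.h / (24 * σ * p ^ 2) * gradQuad α β γ q z ∂arc =
      T.h / (24 * σ * p ^ 2) * (α * ∫ z in T.edge i, ev q1 z ^ 2 ∂arc) +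
      T.h / (24 * σ * p ^ 2) * (δ * ∫ z in T.edge i, ev (dy q) z ^ 2 ∂arc) := by
    intro i
    rw [e, integral_const_mul, integral_add, integral_const_mul, integral_const_mul, mul_add]
    · exact T.integrableOn_edge i (by fun_prop)
    · exact T.integrableOn_edge i (by fun_prop)
  have hvol : ∫ z in T.opn, gradQuad α β γ q z =
      α * (∫ z in T.opn, ev q1 z ^ 2) + δ * ∫ z in T.opn, ev (dy q) z ^ 2 := by
    rw [e, integral_add, integral_const_mul, integral_const_mul]
    · exact T.integrableOn_opn (by fun_prop)
    · exact T.integrableOn_opn (by fun_prop)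
  simp only [hsplit]
  rw [hvol, Finset.sum_add_distrib, ← Finset.mul_sum, ← Finset.mul_sum, ← Finset.mul_sum,
    ← Finset.mul_sum]
  have h3 := mul_le_mul_of_nonneg_left h1 hα.le
  have h4 := mul_le_mul_of_nonneg_left h2 hδ
  linarith

namespace Triangulation

variable {Ω : Set Plane} {𝒯 : Triangulation Ω}

theorem energy_self (α β γ : ℝ) (W : 𝒯.PW) :
    𝒯.energy (matA α β γ) W W = ∑ j, ∫ z in (𝒯.tri j).opn, gradQuad α β γ (W j) z := by
  simp only [energy, grad_dotProduct_matA]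

theorem energy_nonneg {α β γ : ℝ} (hA : (matA α β γ).PosSemidef) (W : 𝒯.PW) :
    0 ≤ 𝒯.energy (matA α β γ) W W := by
  rw [energy_self]
  exact Finset.sum_nonneg fun _ _ => integral_nonneg fun _ => quad_nonneg hA _ _

theorem l2_nonneg (W : 𝒯.PW) : 0 ≤ 𝒯.l2 W W :=
  Finset.sum_nonneg fun _ _ => integral_nonneg fun _ => mul_self_nonneg _

/-- The volume and surface forms control the hypocoercive part. -/
theorem hypocoercive_le (hΩ : interior (closure Ω) = Ω) {p : ℕ} {U : 𝒯.PW}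
    (hU : U ∈ 𝒯.feSpace p) {σ ρ α β γ κ lam Cτ c R D : ℝ} (hα : 0 < α)
    (hA : (matA α β γ).PosSemidef) (hκ : 0 ≤ κ) (hlam : 0 ≤ lam)
    (hp : 1 ≤ p) (hσ : 𝒯.ShapeRegular σ) (hρ : 𝒯.LocallyQuasiUniform ρ) {N : Set Plane}
    (hN : N.Finite) (hc0 : 0 < c) (hR0 : 0 ≤ R)
    (hR : ∀ z ∈ closure Ω, |z 0| ≤ R) (hD : Metric.diam (closure Ω) ≤ D)
    (hc : ∀ z n, z ∉ N → IsOutwardNormal Ω z n → n 0 ≠ 0 → c ≤ n 0 ^ 2) (hCτ : 0 < Cτ)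
    (hC1 : 6 * σ * (1 + ρ) ≤ Cτ) (hC2 : 48 * σ ≤ Cτ) (hC3 : R * D / c ≤ Cτ) :
    ∑ j, ∫ z in (𝒯.tri j).opn, (ev (dx (U j)) z ^ 2 + α * ev (dx (U j)) z * ev (dy (U j)) z
      + β * ev (dy (U j)) z ^ 2) ≤
      𝒯.volumeForm (matA α β γ) U U + 𝒯.sForm p (matA α β γ) κ lam Cτ U U := by
  have hp' : (1 : ℝ) ≤ p := by exact_mod_cast hp
  have hσ0 : ∀ j : Fin 𝒯.n, 0 < σ := fun j => by
    obtain ⟨_, r, hr, _, h⟩ := hσ j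
    exact pos_of_mul_pos_left ((𝒯.tri j).h_pos.trans_le h) hr.le
  have hs := surface_nonneg hΩ hU hA hκ hlam (zero_lt_one.trans_le hp) hCτ
    -- This weight is the constant of the trace estimate. Against it, `hC1` pays for the interfaces,
    -- where the average mesh size is at most `(1 + ρ) / 2` times the local one, `hC2` for the
    -- threshold `2 / τ` on the elliptic boundary, and `hC3` for the transport there.
    (fun j => (𝒯.tri j).h / (24 * σ * p ^ 2)) hN
    (fun j k hjk => by
      have h1 := hρ k j (by rwa [Set.inter_comm])
      have h2 := (𝒯.tri j).h_pos
      have h3 := hσ0 j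
      rw [div_le_div_iff₀ (by positivity) (by positivity)]
      have h4 : avg (𝒯.tri j).h (𝒯.tri k).h ≤ (1 + ρ) / 2 * (𝒯.tri j).h := by
        unfold avg; linarith
      calc _ ≤ (1 + ρ) / 2 * (𝒯.tri j).h * (24 * σ * p ^ 2) :=
            mul_le_mul_of_nonneg_right h4 (by positivity)
        _ = (6 * σ * (1 + ρ)) * (2 * (𝒯.tri j).h * p ^ 2) := by ring
        _ ≤ Cτ * (2 * (𝒯.tri j).h * p ^ 2) := mul_le_mul_of_nonneg_right hC1 (by positivity)
        _ = _ := by ring)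
    (fun j => by
      have h2 := (𝒯.tri j).h_pos
      have h3 := hσ0 j
      rw [div_le_div_iff₀ (by positivity) (by positivity)]
      calc _ = (48 * σ) * ((𝒯.tri j).h * p ^ 2) := by ring
        _ ≤ Cτ * ((𝒯.tri j).h * p ^ 2) := mul_le_mul_of_nonneg_right hC2 (by positivity)
        _ = _ := by ring)
    hR hc
    (fun j => by
      have h2 := (𝒯.tri j).h_pos
      have h3 : (𝒯.tri j).h ≤ D :=
        (Metric.diam_mono (closed_subset_closure j) 𝒯.isBounded_closure).trans hD
      rw [div_le_iff₀ hc0] at hC3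
      rw [div_mul_eq_mul_div, le_div_iff₀ h2]
      calc _ ≤ R * D := mul_le_mul_of_nonneg_left h3 hR0
        _ ≤ Cτ * c * 1 := by linarith
        _ ≤ Cτ * c * p ^ 2 := mul_le_mul_of_nonneg_left (by nlinarith) (by positivity)
        _ = _ := by ring)
  have ht : ∑ j, ∑ i, ∫ z in (𝒯.tri j).edge i,
      (𝒯.tri j).h / (24 * σ * p ^ 2) * gradQuad α β γ (dx (U j)) z ∂arc ≤
      ∑ j, ∫ z in (𝒯.tri j).opn, gradQuad α β γ (dx (U j)) z := by
    refine Finset.sum_le_sum fun j _ => ?_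
    obtain ⟨ctr, r, hr, hsub, h⟩ := hσ j
    exact (𝒯.tri j).sum_edge_gradQuad_le hr hsub h hp
      ((totalDegree_pderiv_le 0 _).trans (hU.1 j)) hα hA
  have hv : 𝒯.volumeForm (matA α β γ) U U =
      (∑ j, ∫ z in (𝒯.tri j).opn, (ev (dx (U j)) z ^ 2 + α * ev (dx (U j)) z * ev (dy (U j)) z
        + β * ev (dy (U j)) z ^ 2))
      + (∑ j, ∫ z in (𝒯.tri j).opn, gradQuad α β γ (dx (U j)) z)
      + ∑ j, ∫ z in (𝒯.tri j).opn, ev (dy (transport α β γ (U j))) z := by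
    simp only [volumeForm, volume_density_eq]
    rw [← Finset.sum_add_distrib, ← Finset.sum_add_distrib]
    refine Finset.sum_congr rfl fun j _ => ?_
    have c1 := continuous_ev (dx (U j))
    have c2 := continuous_ev (dy (U j))
    have c3 := continuous_gradQuad α β γ (dx (U j))
    have c4 := continuous_ev (dy (transport α β γ (U j)))
    rw [integral_add, integral_add]
    all_goals exact (𝒯.tri j).integrableOn_opn (by fun_prop)
  linarith

/-- Coercivity of the discrete form in the modified norm. -/
theorem l2_add_energy_le_of_admissible {α β γ ε μ C : ℝ} (h : Admissible α β γ ε μ)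
    (hC : IsPoincareConstant Ω C) {p : ℕ} {U : 𝒯.PW} (hU : U ∈ 𝒯.feSpace p) :
    min 1 (μ / C) / 2 * (𝒯.l2 U U + 𝒯.energy (matA α β γ) U U) ≤
    ∑ j, ∫ z in (𝒯.tri j).opn, (ev (dx (U j)) z ^ 2 + α * ev (dx (U j)) z * ev (dy (U j)) z
      + β * ev (dy (U j)) z ^ 2) := by
  have h1 : (𝒯.energy (matA α β γ) U U + μ * 𝒯.energy 1 U U) / 2 ≤
      ∑ j, ∫ z in (𝒯.tri j).opn, (ev (dx (U j)) z ^ 2 + α * ev (dx (U j)) z * ev (dy (U j)) z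
      + β * ev (dy (U j)) z ^ 2) := by
    rw [energy_self, energy, Finset.mul_sum, ← Finset.sum_add_distrib, Finset.sum_div]
    refine Finset.sum_le_sum fun j _ => ?_
    have c1 := continuous_ev (dx (U j))
    have c2 := continuous_ev (dy (U j))
    have c3 := continuous_gradQuad α β γ (U j)
    simp only [dotProduct_one_grad]
    rw [← integral_const_mul, ← integral_add, ← integral_div]
    · refine setIntegral_mono_on ((𝒯.tri j).integrableOn_opn (by fun_prop))
        ((𝒯.tri j).integrableOn_opn (by fun_prop)) (𝒯.tri j).isOpen_opn.measurableSet
        fun z _ => ?_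
      have h2 := h.quad_le (ev (dx (U j)) z) (ev (dy (U j)) z)
      have h3 := one_half_quad_le (α := α) β h.ε_pos (ev (dx (U j)) z) (ev (dy (U j)) z)
      unfold gradQuad
      linarith
    all_goals exact (𝒯.tri j).integrableOn_opn (by fun_prop)
  have h2 := hC.2 𝒯 p U hU
  have hC0 := hC.1
  have hμ := h.μ_pos
  have h3 : μ / C * 𝒯.l2 U U ≤ μ * 𝒯.energy 1 U U := by
    calc _ ≤ μ / C * (C * 𝒯.energy 1 U U) := mul_le_mul_of_nonneg_left h2 (by positivity)
      _ = _ := by field_simp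
  have h4 := mul_le_mul_of_nonneg_right (min_le_right 1 (μ / C)) (l2_nonneg U)
  have h5 := mul_le_mul_of_nonneg_right (min_le_left 1 (μ / C)) (energy_nonneg h.posSemidef U)
  linarith

end Triangulation

/-! ### Decay in time -/

theorem grad_add (q r : Poly) (z : Plane) : grad (q + r) z = grad q z + grad r z := by
  ext i; fin_cases i <;> simp [grad, dx, dy]

theorem grad_smul (c : ℝ) (q : Poly) (z : Plane) : grad (c • q) z = c • grad q z := by
  ext i; fin_cases i <;> simp [grad, dx, dy, ev]

theorem ev_smul (c : ℝ) (q : Poly) (z : Plane) : ev (c • q) z = c * ev q z := by simp [ev]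

theorem continuous_energy_density (A : Matrix (Fin 2) (Fin 2) ℝ) (w v : Poly) :
    Continuous fun z => ev w z * ev v z + grad w z ⬝ᵥ A *ᵥ grad v z := by
  have c1 := continuous_ev w
  have c2 := continuous_ev v
  have c3 := continuous_ev (dx w)
  have c4 := continuous_ev (dy w)
  have c5 := continuous_ev (dx v)
  have c6 := continuous_ev (dy v)
  simp only [grad, dotProduct, Matrix.mulVec, Fin.sum_univ_two, Matrix.cons_val_zero,
    Matrix.cons_val_one]
  fun_prop

/-- The form `(w, v) + (∇w, A∇v)` on one triangle. -/
def Triangle.massForm (T : Triangle) (A : Matrix (Fin 2) (Fin 2) ℝ) : Poly →ₗ[ℝ] Poly →ₗ[ℝ] ℝ :=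
  LinearMap.mk₂ ℝ (fun w v => ∫ z in T.opn, (ev w z * ev v z + grad w z ⬝ᵥ A *ᵥ grad v z))
    (fun w w' v => by
      rw [← integral_add (T.integrableOn_opn (continuous_energy_density A w v))
        (T.integrableOn_opn (continuous_energy_density A w' v))]
      congr 1; ext z; rw [ev_add, grad_add, add_dotProduct]; ring)
    (fun c w v => by
      rw [smul_eq_mul, ← integral_const_mul]
      congr 1; ext z; rw [ev_smul, grad_smul, smul_dotProduct, smul_eq_mul]; ring)
    (fun w v v' => by
      rw [← integral_add (T.integrableOn_opn (continuous_energy_density A w v))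
        (T.integrableOn_opn (continuous_energy_density A w v'))]
      congr 1; ext z; rw [ev_add, grad_add, Matrix.mulVec_add, dotProduct_add]; ring)
    (fun c w v => by
      rw [smul_eq_mul, ← integral_const_mul]
      congr 1; ext z
      rw [ev_smul, grad_smul, Matrix.mulVec_smul, dotProduct_smul, smul_eq_mul]; ring)

theorem Triangle.massForm_apply (T : Triangle) (A : Matrix (Fin 2) (Fin 2) ℝ) (w v : Poly) :
    T.massForm A w v = ∫ z in T.opn, (ev w z * ev v z + grad w z ⬝ᵥ A *ᵥ grad v z) := rfl

theorem Triangle.massForm_comm (T : Triangle) (α β γ : ℝ) (w v : Poly) :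
    T.massForm (matA α β γ) w v = T.massForm (matA α β γ) v w := by
  rw [massForm_apply, massForm_apply]
  congr 1; ext z
  simp [grad, matA, dotProduct, Matrix.mulVec, Fin.sum_univ_two]
  ring

/-- A finite set of exponents which contains those of all polynomials of total degree at most
`p`. -/
def exponents (p : ℕ) : Finset (Fin 2 →₀ ℕ) :=
  Finset.Iic (Finsupp.equivFunOnFinite.symm fun _ => p)

theorem eq_sum_exponents {p : ℕ} {q : Poly} (hq : q.totalDegree ≤ p) :
    q = ∑ m ∈ exponents p, q.coeff m • MvPolynomial.monomial m (1 : ℝ) := by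
  conv_lhs => rw [q.as_sum]
  refine (Finset.sum_subset (fun m hm => ?_) fun m _ hm => ?_).trans
    (Finset.sum_congr rfl fun m _ => ?_)
  · rw [exponents, Finset.mem_Iic]
    intro i
    change m i ≤ p
    have := (MvPolynomial.le_totalDegree hm).trans hq
    rw [Finsupp.sum_fintype _ _ (fun _ => rfl)] at this
    exact (Finset.single_le_sum (fun _ _ => Nat.zero_le _) (Finset.mem_univ i)).trans this
  · rw [MvPolynomial.notMem_support_iff.1 hm, map_zero]
  · rw [MvPolynomial.smul_monomial, smul_eq_mul, mul_one]

/-- Regularity in time is given coefficient by coefficient. On polynomials of bounded degree a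
bilinear form is a fixed finite sum in the coefficients, so it inherits that regularity without
differentiating under the integral. -/
theorem bilin_eq_sum_exponents (B : Poly →ₗ[ℝ] Poly →ₗ[ℝ] ℝ) {p : ℕ} {q r : Poly}
    (hq : q.totalDegree ≤ p) (hr : r.totalDegree ≤ p) :
    B q r = ∑ m ∈ exponents p, ∑ m' ∈ exponents p, q.coeff m * r.coeff m' *
      B (MvPolynomial.monomial m 1) (MvPolynomial.monomial m' 1) := by
  conv_lhs => rw [eq_sum_exponents hq, eq_sum_exponents hr]
  simp only [map_sum, map_smul, LinearMap.sum_apply, LinearMap.smul_apply, smul_eq_mul,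
    Finset.mul_sum]
  rw [Finset.sum_comm]
  refine Finset.sum_congr rfl fun m _ => Finset.sum_congr rfl fun m' _ => ?_
  ring

theorem hasDerivWithinAt_bilin_self (B : Poly →ₗ[ℝ] Poly →ₗ[ℝ] ℝ) {p : ℕ} {q : ℝ → Poly}
    {q' : Poly} {s : Set ℝ} {t : ℝ} (ht : t ∈ s) (hq : ∀ t ∈ s, (q t).totalDegree ≤ p)
    (hq' : q'.totalDegree ≤ p)
    (h : ∀ m, HasDerivWithinAt (fun t => (q t).coeff m) (q'.coeff m) s t) :
    HasDerivWithinAt (fun t => B (q t) (q t)) (B q' (q t) + B (q t) q') s t := by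
  rw [bilin_eq_sum_exponents B hq' (hq t ht), bilin_eq_sum_exponents B (hq t ht) hq',
    ← Finset.sum_add_distrib]
  simp only [← Finset.sum_add_distrib]
  refine HasDerivWithinAt.congr (f := fun t => ∑ m ∈ exponents p, ∑ m' ∈ exponents p,
    (q t).coeff m * (q t).coeff m' * B (MvPolynomial.monomial m 1) (MvPolynomial.monomial m' 1))
    ?_ (fun t ht => bilin_eq_sum_exponents B (hq t ht) (hq t ht))
    (bilin_eq_sum_exponents B (hq t ht) (hq t ht))
  refine HasDerivWithinAt.fun_sum fun m _ => HasDerivWithinAt.fun_sum fun m' _ => ?_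
  refine (((h m).mul (h m')).mul_const _).congr_deriv ?_
  ring

theorem continuousOn_bilin_self (B : Poly →ₗ[ℝ] Poly →ₗ[ℝ] ℝ) {p : ℕ} {q : ℝ → Poly}
    {s : Set ℝ} (hq : ∀ t ∈ s, (q t).totalDegree ≤ p)
    (h : ∀ m, ContinuousOn (fun t => (q t).coeff m) s) :
    ContinuousOn (fun t => B (q t) (q t)) s := by
  refine ContinuousOn.congr (f := fun t => ∑ m ∈ exponents p, ∑ m' ∈ exponents p,
    (q t).coeff m * (q t).coeff m' * B (MvPolynomial.monomial m 1) (MvPolynomial.monomial m' 1))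
    ?_ (fun t ht => bilin_eq_sum_exponents B (hq t ht) (hq t ht))
  exact continuousOn_finsetSum _ fun m _ => continuousOn_finsetSum _ fun m' _ =>
    ((h m).mul (h m')).mul continuousOn_const

/-- Exponential decay from a differential inequality. -/
theorem le_exp_mul_of_hasDerivWithinAt {E E' : ℝ → ℝ} {c T : ℝ} (hT : 0 < T)
    (hE : ContinuousOn E (Set.Icc 0 T))
    (hE' : ∀ t ∈ Set.Ioo 0 T, HasDerivWithinAt E (E' t) (Set.Icc 0 T) t)
    (h : ∀ t ∈ Set.Ioo 0 T, E' t ≤ -(c * E t)) : E T ≤ Real.exp (-(c * T)) * E 0 := by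
  have hd : ∀ t ∈ Set.Ioo 0 T, HasDerivAt (fun t => Real.exp (c * t) * E t)
      (Real.exp (c * t) * (c * E t + E' t)) t := by
    intro t ht
    have h1 := (hE' t ht).hasDerivAt (Icc_mem_nhds ht.1 ht.2)
    have h2 : HasDerivAt (fun t => Real.exp (c * t)) (Real.exp (c * t) * c) t := by
      simpa using ((hasDerivAt_id t).const_mul c).exp
    refine (h2.mul h1).congr_deriv ?_
    ring
  have hanti : AntitoneOn (fun t => Real.exp (c * t) * E t) (Set.Icc 0 T) := by
    refine antitoneOn_of_deriv_nonpos (convex_Icc 0 T) ?_ ?_ ?_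
    · exact ContinuousOn.mul (by fun_prop) hE
    · rw [interior_Icc]
      exact fun t ht => (hd t ht).differentiableAt.differentiableWithinAt
    · rw [interior_Icc]
      intro t ht
      rw [(hd t ht).deriv]
      exact mul_nonpos_of_nonneg_of_nonpos (Real.exp_pos _).le (by linarith [h t ht])
  have := hanti (Set.left_mem_Icc.2 hT.le) (Set.right_mem_Icc.2 hT.le) hT.le
  simp only [mul_zero, Real.exp_zero, one_mul] at this
  rw [Real.exp_neg, inv_mul_eq_div, le_div_iff₀ (Real.exp_pos _), mul_comm]
  exact this

/-- The factor `√2` comes from `(√a + √b)² ≤ 2 (a + b)`; on the other side `a' + b' ≤ (√a' + √b')²`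
loses nothing further. -/
theorem sqrt_add_sqrt_le {a b a' b' s : ℝ} (ha : 0 ≤ a) (hb : 0 ≤ b) (ha' : 0 ≤ a')
    (hb' : 0 ≤ b') (h : a + b ≤ Real.exp (-s) * (a' + b')) :
    √a + √b ≤ √2 * Real.exp (-(s / 2)) * (√a' + √b') := by
  refine abs_le_of_sq_le_sq' ?_ (by positivity) |>.2
  have h1 := Real.sq_sqrt ha
  have h2 := Real.sq_sqrt hb
  have h3 := Real.sq_sqrt ha'
  have h4 := Real.sq_sqrt hb'
  have h5 : (√2 * Real.exp (-(s / 2)) * (√a' + √b')) ^ 2 =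
      2 * (Real.exp (-s) * (√a' + √b') ^ 2) := by
    rw [mul_pow, mul_pow, Real.sq_sqrt (by norm_num), ← Real.exp_nat_mul]
    rw [show ((2 : ℕ) : ℝ) * -(s / 2) = -s by push_cast; ring]
    ring
  rw [h5]
  have h6 : a' + b' ≤ (√a' + √b') ^ 2 := by
    nlinarith [mul_nonneg (Real.sqrt_nonneg a') (Real.sqrt_nonneg b')]
  have h7 := mul_le_mul_of_nonneg_left h6 (Real.exp_pos (-s)).le
  nlinarith [sq_nonneg (√a - √b)]

namespace Triangulation

variable {Ω : Set Plane} {𝒯 : Triangulation Ω}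

theorem sum_massForm (A : Matrix (Fin 2) (Fin 2) ℝ) (W V : 𝒯.PW) :
    ∑ j, (𝒯.tri j).massForm A (W j) (V j) = 𝒯.l2 W V + 𝒯.energy A W V := by
  rw [l2, energy, ← Finset.sum_add_distrib]
  refine Finset.sum_congr rfl fun j _ => ?_
  have c1 := continuous_ev (W j)
  have c2 := continuous_ev (V j)
  have h1 : IntegrableOn (fun z => ev (W j) z * ev (V j) z) (𝒯.tri j).opn :=
    (𝒯.tri j).integrableOn_opn (c1.mul c2)
  have h2 := (𝒯.tri j).integrableOn_opn (continuous_energy_density A (W j) (V j))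
  rw [Triangle.massForm_apply, ← integral_add h1]
  have := h2.sub h1
  simpa only [Pi.sub_def, add_sub_cancel_left, IntegrableOn] using this

/-- Decay of the solution of the semidiscrete method when the discrete form is coercive. -/
theorem IsFEMSolution.decay {p : ℕ} {α β γ κ lam Cτ tf c : ℝ} {P : 𝒯.PW} {U : ℝ → 𝒯.PW}
    (hU : 𝒯.IsFEMSolution p (matA α β γ) κ lam Cτ tf P U) (htf : 0 < tf)
    (h : ∀ W ∈ 𝒯.feSpace p, c / 2 * (𝒯.l2 W W + 𝒯.energy (matA α β γ) W W) ≤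
      𝒯.volumeForm (matA α β γ) W W + 𝒯.sForm p (matA α β γ) κ lam Cτ W W) :
    𝒯.l2 (U tf) (U tf) + 𝒯.energy (matA α β γ) (U tf) (U tf) ≤
      Real.exp (-(c * tf)) * (𝒯.l2 P P + 𝒯.energy (matA α β γ) P P) := by
  choose! Ut hUt hder heq using hU.equation
  rw [← hU.init]
  refine le_exp_mul_of_hasDerivWithinAt
    (E := fun t => 𝒯.l2 (U t) (U t) + 𝒯.energy (matA α β γ) (U t) (U t))
    (E' := fun t => 2 * (𝒯.l2 (Ut t) (U t) + 𝒯.energy (matA α β γ) (Ut t) (U t))) htf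
    ?_ (fun t ht => ?_) (fun t ht => ?_)
  · simp only [← sum_massForm]
    exact continuousOn_finsetSum _ fun j _ =>
      continuousOn_bilin_self _ (fun t ht => (hU.mem t ht).1 j) (hU.continuous j)
  · simp only [← sum_massForm]
    have ht' := Set.Ioo_subset_Icc_self ht
    have ht'' := Set.Ioo_subset_Ioc_self ht
    refine (HasDerivWithinAt.fun_sum fun j (_ : j ∈ Finset.univ) =>
      hasDerivWithinAt_bilin_self ((𝒯.tri j).massForm (matA α β γ)) ht'
        (fun t ht => (hU.mem t ht).1 j) ((hUt t ht'').1 j) (hder t ht'' j)).congr_deriv ?_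
    rw [Finset.mul_sum]
    refine Finset.sum_congr rfl fun j _ => ?_
    -- Symmetry of `A` merges the two terms of the product rule into the factor 2.
    rw [(𝒯.tri j).massForm_comm α β γ (U t j) (Ut t j)]
    ring
  · have ht' := hU.mem t (Set.Ioo_subset_Icc_self ht)
    -- Testing the method with the solution itself: half the derivative of the energy is minus the
    -- discrete form, which is coercive.
    have h1 := heq t (Set.Ioo_subset_Ioc_self ht) (U t) ht'
    have h2 := h (U t) ht'
    linarith

end Triangulation

end KolmogorovFEM

end

open KolmogorovFEM
theorem theorem1 (Ω : Set Plane) (hΩ : interior (closure Ω) = Ω) :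
    (∃ CPF : ℝ, IsPoincareConstant Ω CPF) ∧
    (∀ α : ℝ, 0 < α → α < 1 / 2 → ∃ β γ ε μ : ℝ, Admissible α β γ ε μ) ∧
    (∀ σ ρ : ℝ, ∃ C₀ > 0, ∀ Cτ ≥ C₀,
      ∀ α β γ ε μ : ℝ, Admissible α β γ ε μ →
      ∀ CPF : ℝ, IsPoincareConstant Ω CPF →
      ∀ 𝒯 : Triangulation Ω, 𝒯.ShapeRegular σ → 𝒯.LocallyQuasiUniform ρ →
      ∀ p : ℕ, 2 ≤ p → ∀ κ lam : ℝ, 0 ≤ κ → 0 ≤ lam →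
      ∀ u₀ : Plane → ℝ, MeasureTheory.MemLp u₀ 2 (MeasureTheory.volume.restrict Ω) →
      ∀ P : 𝒯.PW, 𝒯.IsL2Projection p u₀ P →
      ∀ tf : ℝ, 0 < tf →
      ∀ U : ℝ → 𝒯.PW, 𝒯.IsFEMSolution p (matA α β γ) κ lam Cτ tf P U →
        𝒯.l2 (U tf) (U tf) + 𝒯.energy (matA α β γ) (U tf) (U tf)
            ≤ Real.exp (-(min 1 (μ / CPF) * tf)) *
              (𝒯.l2 P P + 𝒯.energy (matA α β γ) P P) ∧
        √(𝒯.l2 (U tf) (U tf)) + √(𝒯.energy (matA α β γ) (U tf) (U tf))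
            ≤ √2 * Real.exp (-(min 1 (μ / CPF) * tf / 2)) *
              (√(𝒯.l2 P P) + √(𝒯.energy (matA α β γ) P P))) := by
  refine ⟨Triangulation.exists_isPoincareConstant hΩ, fun α h0 h1 => exists_admissible h0 h1,
    fun σ ρ => ?_⟩
  by_cases hne : Nonempty (Triangulation Ω)
  · obtain ⟨𝒯₀⟩ := hne
    -- One reference triangulation provides `c`, `R` and `D`, which are then used for every other
    -- triangulation. The bound on the normals holds off the finitely many vertices of `𝒯₀`, a null
    -- set for arc length.
    obtain ⟨c, hc0, hc⟩ := Triangulation.exists_pos_le_normal_sq hΩ 𝒯₀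
    obtain ⟨R, hR0, hR⟩ := 𝒯₀.isBounded_closure.exists_pos_norm_le
    set D := Metric.diam (closure Ω)
    have hRD : 0 ≤ R * D / c := by have : 0 ≤ D := Metric.diam_nonneg; positivity
    -- The sum dominates the three lower bounds on `Cτ` needed for coercivity; the absolute values
    -- and the 1 keep it positive for any `σ` and `ρ`.
    refine ⟨1 + |6 * σ * (1 + ρ)| + |48 * σ| + R * D / c, by positivity, ?_⟩
    intro Cτ hCτ α β γ ε μ hadm CPF hCPF 𝒯 hσ hρ p hp κ lam hκ hlam u₀ _ P _ tf htf U hU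
    have h1 := le_abs_self (6 * σ * (1 + ρ))
    have h2 := le_abs_self (48 * σ)
    have h3 := abs_nonneg (6 * σ * (1 + ρ))
    have h4 := abs_nonneg (48 * σ)
    have hdecay := hU.decay htf (c := min 1 (μ / CPF)) fun W hW =>
      (Triangulation.l2_add_energy_le_of_admissible hadm hCPF hW).trans
        (Triangulation.hypocoercive_le hΩ hW hadm.α_pos hadm.posSemidef hκ hlam (by omega) hσ hρ
          𝒯₀.finite_vertices hc0 hR0.le
          (fun z hz => (PiLp.norm_apply_le z 0).trans (hR z hz)) le_rfl hc (by linarith)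
          (by linarith) (by linarith) (by linarith))
    exact ⟨hdecay, sqrt_add_sqrt_le (Triangulation.l2_nonneg _)
      (Triangulation.energy_nonneg hadm.posSemidef _) (Triangulation.l2_nonneg _)
      (Triangulation.energy_nonneg hadm.posSemidef _) hdecay⟩
  · exact ⟨1, one_pos, fun _ _ _ _ _ _ _ _ _ _ 𝒯 => absurd ⟨𝒯⟩ hne⟩
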